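/- **Setting.** All Hilbert spaces are finite-dimensional. Let $n,m\ge 0$ and let $\mathcal H_A=(\mathbb C^2)^{\otimes n}$ have the bit basis $|z\rangle$, $z\in\{0,1\}^n$. Arithmetic of bit strings is modulo 2. For $x,e\in\{0,1\}^n$ put $Z^e|z\rangle=(-1)^{e\cdot z}|z\rangle$, $X^x|z\rangle=|z+x\rangle$ and $|\widetilde x\rangle=2^{-n/2}\sum_z(-1)^{x\cdot z}|z\rangle$. A positive semidefinite operator is sub-normalized if its trace is at most $1$, and normalized if its trace is $1$. *Initial state.* Let $\rho_{AE}=\sum_{a\in\{0,1\}^n}|a\rangle\langle a|_A\otimes\rho_E^a$ be a nonzero sub-normalized classical-quantum state (every $\rho_E^a\ge0$), and let $|\Psi\rangle_{AEA'}$ be any purification of it, i.e. $\mathrm{Tr}_{A'}|\Psi\rangle\langle\Psi|=\rho_{AE}$. The conditional min-entropy $H_{\min}(\rho_{AE}|E)$ is the supremum (in fact maximum) of the real numbers $\lambda$ such that $2^{-\lambda}\,\mathbb I_A\otimes\sigma_E\ge\rho_{AE}$ for some normalized state $\sigma_E$. *Hash functions.* Let $G$ be a random function taking values, with probabilities $\Pr(G=g)$,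 in a finite family of linear surjective maps $g:\{0,1\}^n\to\{0,1\}^m$. It is universal$_2$ if $\Pr(G(a)=G(a'))\le 2^{-m}$ for all $a\ne a'$. For each $g$ of the family fix a check matrix $h^g$ of the code $C^g=(\ker g)^\perp$: an $(n-m)\times n$ binary matrix, with rows $h^g_1,\dots,h^g_{n-m}$, whose kernel is $C^g$. *Phase error correction.* For each $g$ of the family and each $s\in\{0,1\}^{n-m}$ let $M^{g,s}=\{E^{g,s,e}_{A'}\mid e\in\{0,1\}^n\}$ be operators on $\mathcal H_{A'}$ with $\sum_e E^{g,s,e\,\dagger}E^{g,s,e}=\mathbb I_{A'}$. The operation $\Pi^{\mathrm{pec},g}$ measures in $\mathcal H_A$ the eigenvalues $(-1)^{s_j}$ of the commuting operators $X^{h^g_j}$, $j=1,\dots,n-m$, then measures $\mathcal H_{A'}$ with $M^{g,s}$, obtaining $e$, and applies $Z^e$ to $\mathcal H_A$. That is, with $P^g_s=\prod_j\tfrac12\bigl(\mathbb I+(-1)^{s_j}X^{h^g_j}\bigr)$, $$\rho^{\mathrm{pec},g}=\sum_{s,e}\bigl(Z^eP^g_s\otimes\mathbb I_E\otimes E^{g,s,e}\bigr)\,|\Psi\rangle\langle\Psi|\,\bigl(Z^eP^g_s\otimes\mathbb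 I_E\otimes E^{g,s,e}\bigr)^\dagger .$$ Its failure probability (phase error probability) is $$P^{\mathrm{ph}}_A(\rho^{\mathrm{pec},g})=\mathrm{Tr}\,\rho^{\mathrm{pec},g}_A-\langle\widetilde 0|\rho^{\mathrm{pec},g}_A|\widetilde 0\rangle,\qquad \rho_A^{\mathrm{pec},g}=\mathrm{Tr}_{EA'}\,\rho^{\mathrm{pec},g},$$ which is $1-\langle\widetilde 0|\rho^{\mathrm{pec},g}_A|\widetilde 0\rangle$ when $\rho_{AE}$ is normalized. **Theorem (coding theorem of the quantum phase error correction).** If $G$ is universal$_2$, then the ancilla measurements $M^{g,s}$ can be chosen such that $$\sum_g\Pr(G=g)\,P^{\mathrm{ph}}_A\bigl(\rho^{\mathrm{pec},g}\bigr)\le 2^{\,m-H_{\min}(\rho_{AE}|E)} .$$ -/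

import Mathlib

open scoped Matrix Kronecker ComplexOrder

noncomputable section

namespace PhaseEC

/-- Bit strings of length `d`, with arithmetic modulo 2. The `d`-qubit space is `ℂ^(Bits d)`,
whose standard basis is the bit basis `|z⟩`. -/
abbrev Bits (d : ℕ) : Type := Fin d → ZMod 2

/-- The sign `(-1)^b` of a bit. -/
def sgn (b : ZMod 2) : ℂ := (-1) ^ b.val

/-- `Z^e`, with `Z^e |z⟩ = (-1)^(e·z) |z⟩`. -/
def pauliZ {d : ℕ} (e : Bits d) : Matrix (Bits d) (Bits d) ℂ :=
  Matrix.diagonal fun z => sgn (e ⬝ᵥ z)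

/-- `X^x`, with `X^x |z⟩ = |z + x⟩`. -/
def pauliX {d : ℕ} (x : Bits d) : Matrix (Bits d) (Bits d) ℂ :=
  Matrix.of fun i j => if i = j + x then 1 else 0

/-- The phase basis vector `2^(-d/2) ∑_z (-1)^(x·z) |z⟩`. -/
def phaseKet {d : ℕ} (x : Bits d) : Bits d → ℂ :=
  fun z => (((Real.sqrt (2 ^ d))⁻¹ : ℝ) : ℂ) * sgn (x ⬝ᵥ z)

/-- The operator `|ψ⟩⟨ψ|`. -/
def ketbra {ι : Type*} (ψ : ι → ℂ) : Matrix ι ι ℂ :=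
  Matrix.vecMulVec ψ (star ψ)

/-- Partial trace over the second tensor factor. -/
def ptrace {ι κ : Type*} [Fintype κ] (ρ : Matrix (ι × κ) (ι × κ) ℂ) : Matrix ι ι ℂ :=
  Matrix.of fun i j => ∑ k, ρ (i, k) (j, k)

/-- Positive semidefinite with trace at most one. -/
def IsSubnormalized {ι : Type*} [Fintype ι] (ρ : Matrix ι ι ℂ) : Prop :=
  ρ.PosSemidef ∧ ρ.trace.re ≤ 1

/-- Positive semidefinite with trace one. -/
def IsNormalized {ι : Type*} [Fintype ι] (ρ : Matrix ι ι ℂ) : Prop :=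
  ρ.PosSemidef ∧ ρ.trace = 1

/-- Classical-quantum: `ρ = ∑_a |a⟩⟨a| ⊗ ρ^a` with every `ρ^a` positive semidefinite. -/
def IsCQ {n : ℕ} {E : Type*} [Fintype E]
    (ρ : Matrix (Bits n × E) (Bits n × E) ℂ) : Prop :=
  ∃ r : Bits n → Matrix E E ℂ, (∀ a, (r a).PosSemidef) ∧
    ρ = ∑ a, Matrix.single a a (1 : ℂ) ⊗ₖ r a

/-- `Ψ` in `A ⊗ E ⊗ A'` is a purification of `ρ` in `A ⊗ E`. -/
def IsPurification {ι κ : Type*} [Fintype κ] (Ψ : ι × κ → ℂ) (ρ : Matrix ι ι ℂ) : Prop :=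
  ptrace (ketbra Ψ) = ρ

/-- The real numbers `l` with `2^(-l) 𝟙_A ⊗ σ_E ≥ ρ_AE` for some normalized state `σ_E`. -/
def minEntropySet {A E : Type*} [Fintype A] [DecidableEq A] [Fintype E]
    (ρ : Matrix (A × E) (A × E) ℂ) : Set ℝ :=
  {l : ℝ | ∃ σ : Matrix E E ℂ, IsNormalized σ ∧
    ((((2 : ℝ) ^ (-l) : ℝ) : ℂ) • ((1 : Matrix A A ℂ) ⊗ₖ σ) - ρ).PosSemidef}

/-- The conditional min-entropy `H_min(ρ_AE|E)`. The set is nonempty and bounded above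
whenever `ρ` is positive semidefinite and nonzero. -/
def minEntropy {A E : Type*} [Fintype A] [DecidableEq A] [Fintype E]
    (ρ : Matrix (A × E) (A × E) ℂ) : ℝ :=
  sSup (minEntropySet ρ)

/-- A random hash function: a family of surjective linear functions `{0,1}^n → {0,1}^m`
together with a probability distribution on it. -/
structure RandomHash (n m : ℕ) where
  family : Finset (Bits n →ₗ[ZMod 2] Bits m)
  prob : (Bits n →ₗ[ZMod 2] Bits m) → ℝ
  prob_nonneg : ∀ g ∈ family, 0 ≤ prob g
  prob_sum : ∑ g ∈ family, prob g = 1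
  surjective : ∀ g ∈ family, Function.Surjective g

/-- Universal₂: distinct inputs collide with probability at most `2^(-m)`. -/
def RandomHash.IsUniversal₂ {n m : ℕ} (G : RandomHash n m) : Prop :=
  ∀ a a' : Bits n, a ≠ a' →
    ∑ g ∈ G.family, G.prob g * (if g a = g a' then 1 else 0) ≤ ((2 : ℝ) ^ m)⁻¹

/-- The classical code `C^g = (ker g)^⊥`. -/
def code {n m : ℕ} (g : Bits n →ₗ[ZMod 2] Bits m) : Set (Bits n) :=
  {x | ∀ a : Bits n, g a = 0 → x ⬝ᵥ a = 0}

/-- `h` is a check matrix of the code `C`: `C` is its kernel. For a code of dimension `m` and a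
matrix with `n - m` rows this forces the rows to be linearly independent. -/
def IsCheckMatrix {n r : ℕ} (h : Matrix (Fin r) (Fin n) (ZMod 2)) (C : Set (Bits n)) : Prop :=
  ∀ x : Bits n, x ∈ C ↔ h *ᵥ x = 0

/-- The operator of the syndrome measurement with outcome `s`: the product over `j` of the
projections `(𝟙 + (-1)^(s_j) X^(h_j)) / 2` onto the eigenspace of the syndrome operator `X^(h_j)`
with eigenvalue `(-1)^(s_j)`. The factors commute. -/
def syndromeProj {n r : ℕ} (h : Matrix (Fin r) (Fin n) (ZMod 2)) (s : Bits r) :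
    Matrix (Bits n) (Bits n) ℂ :=
  (List.ofFn fun j => (2⁻¹ : ℂ) • (1 + sgn (s j) • pauliX (h j))).prod

/-- A measurement on the ancilla space with outcomes `e ∈ {0,1}^n`: `∑_e (E^e)† E^e = 𝟙`. -/
def IsMeasurement {n : ℕ} {A' : Type*} [Fintype A'] [DecidableEq A']
    (M : Bits n → Matrix A' A' ℂ) : Prop :=
  ∑ e, (M e)ᴴ * M e = 1

/-- The phase error correction as a map on operators of `(A ⊗ E) ⊗ A'`: syndrome measurement in
`A` with check matrix `h`, giving `s`; ancilla measurement `M s` in `A'`, giving `e`; phase flip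
`Z^e` in `A`. The outcomes are summed over. -/
def pec {n r : ℕ} {E A' : Type*} [Fintype E] [DecidableEq E] [Fintype A']
    (h : Matrix (Fin r) (Fin n) (ZMod 2)) (M : Bits r → Bits n → Matrix A' A' ℂ)
    (ρ : Matrix ((Bits n × E) × A') ((Bits n × E) × A') ℂ) :
    Matrix ((Bits n × E) × A') ((Bits n × E) × A') ℂ :=
  ∑ s : Bits r, ∑ e : Bits n,
    (((pauliZ e * syndromeProj h s) ⊗ₖ (1 : Matrix E E ℂ)) ⊗ₖ M s e) * ρ *
      (((pauliZ e * syndromeProj h s) ⊗ₖ (1 : Matrix E E ℂ)) ⊗ₖ M s e)ᴴ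

/-- The phase error probability of an operator on the `n`-qubit space: the weight
`Tr ρ - ⟨0~|ρ|0~⟩` of all phases other than `0`. -/
def phaseErrorProb {n : ℕ} (ρ : Matrix (Bits n) (Bits n) ℂ) : ℝ :=
  (ρ.trace - star (phaseKet 0) ⬝ᵥ (ρ *ᵥ phaseKet 0)).re

/-- For a normalized state the phase error probability is `1 - ⟨0~|ρ|0~⟩`. -/
theorem phaseErrorProb_of_trace_eq_one {n : ℕ} (ρ : Matrix (Bits n) (Bits n) ℂ)
    (h : ρ.trace = 1) :
    phaseErrorProb ρ = 1 - (star (phaseKet 0) ⬝ᵥ (ρ *ᵥ phaseKet 0)).re := by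
  simp [phaseErrorProb, h]

end PhaseEC

end

open scoped Matrix Kronecker ComplexOrder

noncomputable section

namespace PhaseEC

/-! Write `T a` for the component of the purification at `|a⟩`, a matrix from the ancilla to `E`.
Classicality of `A` says `T a * (T b)ᴴ = δ_ab q a`. Put `S = ∑ q a`. Phase error correction succeeds
when the ancilla measurement identifies the phase component `2^(-n/2) ∑ (-1)^(e·a) T a` among those
with the same syndrome, that is, within a coset of `C^g`.

The decoder is a pretty-good-measurement construction adapted to the hash. With `R_k = ∑_{g a = k}
S^(-1/4) q_a S^(-1/4)`, so that `∑ R_k = S^(1/2)`, it uses `W_e = 2^(-m/2) ∑ (-1)^(e·a) R_{g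
a}^(-1/2) S^(-1/4) T_a`. Within a coset, `e ↦ W_e` is a Fourier transform over the bins `k`, so by
Parseval `∑ W_eᴴ W_e` is a projection (`one_sub_sum_decoder_posSemidef`). The rest of the identity
is added to one outcome (`exists_measurement_ge`).

All phases have the same amplitude up to normalization, `Y = ∑ R_k^(1/2) S^(1/4)`, and the success
weight is at least `2^(-m) Tr Yᴴ Y`. Completing a square and a scalar quartic inequality give the
lower bound `2 Tr S - 2^m ∑ Tr R_k²` (`le_trace_rootSum`). Hence the failure is at most `2^m ∑ Tr
R_k² - Tr S`. On averaging over a universal₂ hash, the colliding pairs `a ≠ b` contribute at most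
`Tr S`, which cancels (`sum_prob_mul_trace_bin_le`). What remains is `2^m` times the collision
quantity `∑ Tr (S^(-1/4) q_a S^(-1/4))²`, and this is at most `2^(-λ)` for every `λ` admissible in
the min-entropy (`sum_trace_sandwich_mul_self_le`). -/

/-! ### Signs, the phase basis and the syndrome projections. -/

theorem sgn_zero : sgn 0 = 1 := by simp [sgn]

theorem sgn_one : sgn 1 = -1 := by simp [sgn, ZMod.val_one]

theorem sgn_add (a b : ZMod 2) : sgn (a + b) = sgn a * sgn b := by
  obtain rfl | rfl : a = 0 ∨ a = 1 := by revert a; decide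
  · rw [zero_add, sgn_zero, one_mul]
  obtain rfl | rfl : b = 0 ∨ b = 1 := by revert b; decide
  · rw [add_zero, sgn_zero, mul_one]
  rw [CharTwo.add_self_eq_zero, sgn_zero, sgn_one]
  norm_num

theorem sgn_mul_self (a : ZMod 2) : sgn a * sgn a = 1 := by
  rw [← sgn_add, CharTwo.add_self_eq_zero, sgn_zero]

theorem star_sgn (a : ZMod 2) : star (sgn a) = sgn a := by
  simp [sgn]

theorem sgn_ne_zero_eq (b : ZMod 2) (hb : b ≠ 0) : sgn b = -1 := by
  have : b = 1 := by revert b; decide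
  rw [this, sgn_one]

/-- Orthogonality of the characters of `{0,1}^d`. -/
theorem sum_sgn_dotProduct {d : ℕ} (z : Bits d) :
    ∑ x : Bits d, sgn (x ⬝ᵥ z) = if z = 0 then (2 : ℂ) ^ d else 0 := by
  split_ifs with hz
  · subst hz
    simp [sgn_zero, ZMod.card]
  · obtain ⟨i, hi⟩ : ∃ i, z i ≠ 0 := by
      by_contra! hc
      exact hz (funext hc)
    have key : ∑ x : Bits d, sgn (x ⬝ᵥ z) = - ∑ x : Bits d, sgn (x ⬝ᵥ z) := by
      conv_lhs => rw [← Equiv.sum_comp (Equiv.addRight (Pi.single i 1 : Bits d))]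
      rw [← Finset.sum_neg_distrib]
      refine Finset.sum_congr rfl fun x _ => ?_
      simp [add_dotProduct, sgn_add, sgn_ne_zero_eq _ hi]
    linear_combination (1 / 2 : ℂ) * key

theorem add_eq_zero_iff_bits {d : ℕ} (a b : Bits d) : a + b = 0 ↔ a = b := by
  rw [add_eq_zero_iff_eq_neg, show -b = b from funext fun i => CharTwo.neg_eq (b i)]

/-- The normalization constant `2^(-d/2)` of the phase basis. -/
def phaseNorm (d : ℕ) : ℂ := (((Real.sqrt (2 ^ d))⁻¹ : ℝ) : ℂ)

theorem phaseKet_apply {d : ℕ} (x z : Bits d) : phaseKet x z = phaseNorm d * sgn (x ⬝ᵥ z) := rfl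

theorem star_phaseNorm (d : ℕ) : star (phaseNorm d) = phaseNorm d := by
  simp [phaseNorm]

theorem phaseNorm_mul_self (d : ℕ) : phaseNorm d * phaseNorm d = ((2 : ℂ) ^ d)⁻¹ := by
  rw [phaseNorm, ← Complex.ofReal_mul, ← mul_inv, Real.mul_self_sqrt (by positivity)]
  push_cast
  rfl

theorem star_phaseKet {d : ℕ} (x : Bits d) : star (phaseKet x) = phaseKet x := by
  ext z
  simp only [Pi.star_apply, phaseKet_apply, star_mul', star_phaseNorm, star_sgn]

theorem phaseKet_vecMul_pauliX {d : ℕ} (x y : Bits d) :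
    phaseKet x ᵥ* pauliX y = sgn (y ⬝ᵥ x) • phaseKet x := by
  ext j
  simp only [Matrix.vecMul, dotProduct, pauliX, Matrix.of_apply, mul_ite, mul_one, mul_zero,
    Finset.sum_ite_eq', Finset.mem_univ, if_true, Pi.smul_apply, smul_eq_mul]
  rw [phaseKet_apply, phaseKet_apply, dotProduct_add, sgn_add, ← dotProduct, dotProduct_comm y x]
  ring

theorem phaseKet_vecMul_pauliZ {d : ℕ} (e : Bits d) :
    phaseKet 0 ᵥ* pauliZ e = phaseKet e := by
  ext j
  simp [pauliZ, Matrix.vecMul_diagonal, phaseKet_apply, sgn_zero]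

/-- The phase vectors are common eigenvectors of all `X^(h_j)`, so each factor acts as 1 or 0
according to whether one syndrome bit agrees. Row vectors are used because the success weight is
computed from the bra of phase `0`. -/
theorem phaseKet_vecMul_syndromeProj {n r : ℕ} (h : Matrix (Fin r) (Fin n) (ZMod 2))
    (s : Bits r) (x : Bits n) :
    phaseKet x ᵥ* syndromeProj h s = (if h *ᵥ x = s then 1 else 0 : ℂ) • phaseKet x := by
  have factor (j : Fin r) : phaseKet x ᵥ* ((2⁻¹ : ℂ) • (1 + sgn (s j) • pauliX (h j))) =
      (if (h *ᵥ x) j = s j then 1 else 0 : ℂ) • phaseKet x := by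
    rw [Matrix.vecMul_smul, Matrix.vecMul_add, Matrix.vecMul_one, Matrix.vecMul_smul,
      phaseKet_vecMul_pauliX, smul_smul, ← sgn_add]
    have : (h *ᵥ x) j = h j ⬝ᵥ x := rfl
    rw [this]
    split_ifs with hc
    · rw [hc, CharTwo.add_self_eq_zero, sgn_zero, one_smul, ← two_smul ℂ (phaseKet x),
        smul_smul]
      norm_num
    · rw [sgn_ne_zero_eq (s j + h j ⬝ᵥ x)]
      · simp
      · intro h0
        rw [add_eq_zero_iff_eq_neg, CharTwo.neg_eq] at h0
        exact hc h0.symm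
  have list (l : List (Fin r)) :
      phaseKet x ᵥ* (l.map fun j => (2⁻¹ : ℂ) • (1 + sgn (s j) • pauliX (h j))).prod =
        (if ∀ j ∈ l, (h *ᵥ x) j = s j then 1 else 0 : ℂ) • phaseKet x := by
    induction l with
    | nil => simp
    | cons j l ih =>
      rw [List.map_cons, List.prod_cons, ← Matrix.vecMul_vecMul, factor, Matrix.smul_vecMul, ih,
        smul_smul]
      congr 1
      by_cases h1 : (h *ᵥ x) j = s j <;> simp [h1]
  rw [syndromeProj, List.ofFn_eq_map, list]
  simp [funext_iff]

/-- The change from the bit basis to the phase basis. -/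
def hadamard (d : ℕ) : Matrix (Bits d) (Bits d) ℂ := Matrix.of fun x z => phaseKet x z

theorem hadamard_conjTranspose_mul_self (d : ℕ) : (hadamard d)ᴴ * hadamard d = 1 := by
  ext i j
  have : ((hadamard d)ᴴ * hadamard d) i j =
      ((2 : ℂ) ^ d)⁻¹ * ∑ x : Bits d, sgn (x ⬝ᵥ (i + j)) := by
    rw [Matrix.mul_apply, Finset.mul_sum]
    refine Finset.sum_congr rfl fun x _ => ?_
    simp only [hadamard, Matrix.conjTranspose_apply, Matrix.of_apply, phaseKet_apply, star_mul',
      star_phaseNorm, star_sgn]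
    rw [dotProduct_add, sgn_add, ← phaseNorm_mul_self]
    ring
  rw [this, sum_sgn_dotProduct, Matrix.one_apply]
  simp only [add_eq_zero_iff_bits]
  split_ifs <;> simp

theorem hadamard_mul_syndromeProj {n r : ℕ} (h : Matrix (Fin r) (Fin n) (ZMod 2))
    (s : Bits r) : hadamard n * syndromeProj h s =
      Matrix.diagonal (fun x => if h *ᵥ x = s then 1 else 0) * hadamard n := by
  ext x z
  have := congrFun (phaseKet_vecMul_syndromeProj h s x) z
  rw [Matrix.diagonal_mul]
  exact this

/-- In the phase basis the projections are the indicators of the syndrome classes, which partition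
all bit strings. -/
theorem sum_syndromeProj_conjTranspose_mul_self {n r : ℕ} (h : Matrix (Fin r) (Fin n) (ZMod 2)) :
    ∑ s, (syndromeProj h s)ᴴ * syndromeProj h s = 1 := by
  have (s : Bits r) : (syndromeProj h s)ᴴ * syndromeProj h s =
      (hadamard n)ᴴ * Matrix.diagonal (fun x => if h *ᵥ x = s then (1 : ℂ) else 0) *
        hadamard n := by
    have e : (syndromeProj h s)ᴴ * syndromeProj h s =
        (hadamard n * syndromeProj h s)ᴴ * (hadamard n * syndromeProj h s) := by
      rw [Matrix.conjTranspose_mul, Matrix.mul_assoc, ← Matrix.mul_assoc (hadamard n)ᴴ,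
        hadamard_conjTranspose_mul_self, Matrix.one_mul]
    rw [e, hadamard_mul_syndromeProj, Matrix.conjTranspose_mul, Matrix.diagonal_conjTranspose,
      Matrix.mul_assoc, ← Matrix.mul_assoc (Matrix.diagonal _), Matrix.diagonal_mul_diagonal,
      Matrix.mul_assoc]
    congr 3
    ext x
    by_cases hx : h *ᵥ x = s <;> simp [hx]
  simp_rw [this]
  rw [← Finset.sum_mul, ← Finset.mul_sum]
  have : ∑ s, Matrix.diagonal (fun x => if h *ᵥ x = s then (1 : ℂ) else 0) = 1 := by
    ext i j
    rw [Matrix.sum_apply]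
    by_cases hij : i = j
    · subst hij
      simp
    · simp [hij]
  rw [this, Matrix.mul_one, hadamard_conjTranspose_mul_self]

theorem pauliZ_conjTranspose_mul_self {d : ℕ} (e : Bits d) : (pauliZ e)ᴴ * pauliZ e = 1 := by
  rw [pauliZ, Matrix.diagonal_conjTranspose, Matrix.diagonal_mul_diagonal]
  simp only [Pi.star_apply, star_sgn, sgn_mul_self, Matrix.diagonal_one]

/-! ### Functions of Hermitian matrices and trace inequalities. -/

section FunctionalCalculus

variable {ι : Type*} [Fintype ι] [DecidableEq ι] {A B : Matrix ι ι ℂ}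

/-- The function `f` of the Hermitian matrix `A`. -/
def hfun (hA : A.IsHermitian) (f : ℝ → ℝ) : Matrix ι ι ℂ :=
  (hA.eigenvectorUnitary : Matrix ι ι ℂ) *
    Matrix.diagonal (fun i => ((f (hA.eigenvalues i) : ℝ) : ℂ)) *
      (hA.eigenvectorUnitary : Matrix ι ι ℂ)ᴴ

theorem eigenvectorUnitary_conjTranspose_mul_self (hA : A.IsHermitian) :
    (hA.eigenvectorUnitary : Matrix ι ι ℂ)ᴴ * (hA.eigenvectorUnitary : Matrix ι ι ℂ) = 1 :=
  Unitary.coe_star_mul_self hA.eigenvectorUnitary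

theorem hfun_id (hA : A.IsHermitian) : hfun hA (fun x => x) = A := by
  conv_rhs => rw [hA.spectral_theorem]
  rfl

theorem hfun_mul (hA : A.IsHermitian) (f g : ℝ → ℝ) :
    hfun hA f * hfun hA g = hfun hA (fun x => f x * g x) := by
  simp only [hfun, Matrix.mul_assoc]
  rw [← Matrix.mul_assoc _ᴴ, eigenvectorUnitary_conjTranspose_mul_self, Matrix.one_mul,
    ← Matrix.mul_assoc (Matrix.diagonal _), Matrix.diagonal_mul_diagonal]
  simp

theorem hfun_isHermitian (hA : A.IsHermitian) (f : ℝ → ℝ) : (hfun hA f)ᴴ = hfun hA f := by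
  simp only [hfun, Matrix.conjTranspose_mul, Matrix.conjTranspose_conjTranspose,
    Matrix.diagonal_conjTranspose, Matrix.mul_assoc]
  congr 3
  ext i
  simp

theorem hfun_congr (hA : A.PosSemidef) {f g : ℝ → ℝ} (h : ∀ x, 0 ≤ x → f x = g x) :
    hfun hA.1 f = hfun hA.1 g := by
  simp only [hfun, fun i => h _ (hA.eigenvalues_nonneg i)]

/-- The weights are the squared overlaps of the two eigenbases. They do not depend on `f` and `g`,
so a scalar inequality in one eigenvalue of each matrix gives a trace inequality for non-commuting
matrices. -/
theorem hfun_trace_mul (hA : A.IsHermitian) (hB : B.IsHermitian) (f g : ℝ → ℝ) :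
    (hfun hA f * hfun hB g).trace.re = ∑ i, ∑ j, f (hA.eigenvalues i) * g (hB.eigenvalues j) *
      Complex.normSq (((hA.eigenvectorUnitary : Matrix ι ι ℂ)ᴴ *
        (hB.eigenvectorUnitary : Matrix ι ι ℂ)) i j) := by
  set W := (hA.eigenvectorUnitary : Matrix ι ι ℂ)ᴴ * (hB.eigenvectorUnitary : Matrix ι ι ℂ)
    with hW
  have : (hfun hA f * hfun hB g).trace =
      (Matrix.diagonal (fun i => ((f (hA.eigenvalues i) : ℝ) : ℂ)) * W *
        (Matrix.diagonal (fun i => ((g (hB.eigenvalues i) : ℝ) : ℂ)) * Wᴴ)).trace := by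
    rw [hW, Matrix.conjTranspose_mul, Matrix.conjTranspose_conjTranspose]
    simp only [hfun, Matrix.mul_assoc]
    rw [Matrix.trace_mul_comm]
    simp only [Matrix.mul_assoc]
  rw [this, Matrix.trace, Complex.re_sum]
  refine Finset.sum_congr rfl fun i _ => ?_
  rw [Matrix.diag_apply, Matrix.mul_apply, Complex.re_sum]
  refine Finset.sum_congr rfl fun j _ => ?_
  rw [Matrix.diagonal_mul, Matrix.diagonal_mul, Matrix.conjTranspose_apply]
  have : (f (hA.eigenvalues i) : ℂ) * W i j * ((g (hB.eigenvalues j) : ℂ) * star (W i j)) =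
      ((f (hA.eigenvalues i) * g (hB.eigenvalues j) * Complex.normSq (W i j) : ℝ) : ℂ) := by
    push_cast
    rw [Complex.normSq_eq_conj_mul_self, starRingEnd_apply]
    ring
  rw [this, Complex.ofReal_re]

theorem trace_mul_nonneg (hA : A.PosSemidef) (hB : B.PosSemidef) :
    0 ≤ (A * B).trace.re := by
  conv_rhs => rw [← hfun_id hA.1, ← hfun_id hB.1]
  rw [hfun_trace_mul]
  exact Finset.sum_nonneg fun i _ => Finset.sum_nonneg fun j _ =>
    mul_nonneg (mul_nonneg (hA.eigenvalues_nonneg i) (hB.eigenvalues_nonneg j))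
      (Complex.normSq_nonneg _)

/-- The positive square root as a matrix `C` with `Cᴴ C = A`. -/
theorem exists_conjTranspose_eq_mul_self_eq (hA : A.PosSemidef) :
    ∃ C : Matrix ι ι ℂ, Cᴴ = C ∧ C * C = A := by
  refine ⟨hfun hA.1 Real.sqrt, hfun_isHermitian _ _, ?_⟩
  rw [hfun_mul, hfun_congr hA (g := fun x => x) fun x hx => Real.mul_self_sqrt hx, hfun_id]

/-- The fourth root of a nonnegative number. -/
def fourthRoot (x : ℝ) : ℝ := Real.sqrt (Real.sqrt x)

theorem fourthRoot_nonneg (x : ℝ) : 0 ≤ fourthRoot x := Real.sqrt_nonneg _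

theorem fourthRoot_pow_four {x : ℝ} (hx : 0 ≤ x) : fourthRoot x ^ 4 = x := by
  rw [fourthRoot, show 4 = 2 * 2 from rfl, pow_mul, Real.sq_sqrt (Real.sqrt_nonneg _),
    Real.sq_sqrt hx]

/-- A comparison of `Tr D^(1/2) S^(3/4)`, `Tr D S^(1/2)` and `Tr D²`. -/
theorem trace_sqrt_mul_fourthRoot_cube (hA : A.PosSemidef) (hB : B.PosSemidef) {c : ℝ}
    (hc : 0 < c) :
    3 * (A * hfun hB.1 (fun x => fourthRoot x ^ 2)).trace.re - c ^ 2 * (A * A).trace.re ≤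
      2 * c⁻¹ * (hfun hA.1 Real.sqrt * hfun hB.1 (fun x => fourthRoot x ^ 3)).trace.re := by
  -- The constant function of `B` is inserted so that all three traces become sums with the same
  -- weights.
  have h1 : A * A = hfun hA.1 (fun x => x * x) * hfun hB.1 (fun _ => 1) := by
    have : hfun hB.1 (fun _ => 1) = 1 := by
      rw [hfun]
      simp only [Complex.ofReal_one, Matrix.diagonal_one, Matrix.mul_one]
      exact Unitary.coe_mul_star_self hB.1.eigenvectorUnitary
    rw [this, Matrix.mul_one, ← hfun_mul, hfun_id]
  have h2 : A * hfun hB.1 (fun x => fourthRoot x ^ 2) =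
      hfun hA.1 (fun x => x) * hfun hB.1 (fun x => fourthRoot x ^ 2) := by
    rw [hfun_id]
  rw [h1, h2]
  simp only [hfun_trace_mul, Finset.mul_sum, ← Finset.sum_sub_distrib]
  refine Finset.sum_le_sum fun i _ => Finset.sum_le_sum fun j _ => ?_
  set w := Complex.normSq _
  have hw : 0 ≤ w := Complex.normSq_nonneg _
  have hr := fourthRoot_nonneg (hB.1.eigenvalues j)
  set r := fourthRoot (hB.1.eigenvalues j)
  have hu := Real.sqrt_nonneg (hA.1.eigenvalues i)
  have hu2 := Real.sq_sqrt (hA.eigenvalues_nonneg i)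
  set u := Real.sqrt (hA.1.eigenvalues i)
  rw [← hu2]
  -- With `t = c * u`, this is `t⁴ - 3t²r² + 2tr³ = t (t - r)² (t + 2r)`, divided by `c²`. The
  -- double zero `t = r` is the case of perfectly uniform bins when `c² = 2^m`.
  have key : 0 ≤ c⁻¹ ^ 2 * ((c * u) * (c * u - r) ^ 2 * (c * u + 2 * r)) * w := by positivity
  have e : c⁻¹ ^ 2 * ((c * u) * (c * u - r) ^ 2 * (c * u + 2 * r)) =
      c ^ 2 * u ^ 4 - 3 * u ^ 2 * r ^ 2 + 2 * c⁻¹ * u * r ^ 3 := by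
    field_simp
    ring
  rw [e] at key
  nlinarith [key]

end FunctionalCalculus

/-! ### The phase error probability in terms of the components of the purification. -/

section Correction

variable {n r : ℕ} {E A' : Type*} [Fintype E] [Fintype A']

/-- The component of `Ψ` at `|a⟩`, as a matrix from the ancilla to `E`. -/
def bitComp {ι : Type*} (Ψ : (ι × E) × A' → ℂ) (a : ι) : Matrix E A' ℂ :=
  Matrix.of fun e α => Ψ ((a, e), α)

/-- The component of `Ψ` at the phase basis vector of `x`. -/
def phaseComp (Ψ : (Bits n × E) × A' → ℂ) (x : Bits n) : Matrix E A' ℂ :=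
  ∑ a, phaseKet x a • bitComp Ψ a

theorem trace_ptrace {ι κ : Type*} [Fintype ι] [Fintype κ] (ρ : Matrix (ι × κ) (ι × κ) ℂ) :
    (ptrace ρ).trace = ρ.trace := by
  simp [Matrix.trace, ptrace, Fintype.sum_prod_type]

theorem ptrace_sum {ι κ τ : Type*} [Fintype κ] (s : Finset τ)
    (ρ : τ → Matrix (ι × κ) (ι × κ) ℂ) : ptrace (∑ i ∈ s, ρ i) = ∑ i ∈ s, ptrace (ρ i) := by
  ext i j
  simp only [ptrace, Matrix.of_apply, Matrix.sum_apply]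
  exact Finset.sum_comm

theorem mul_ketbra_mul_conjTranspose {ι : Type*} [Fintype ι] (K : Matrix ι ι ℂ) (ψ : ι → ℂ) :
    K * ketbra ψ * Kᴴ = ketbra (K *ᵥ ψ) := by
  rw [ketbra, ketbra, Matrix.mul_vecMulVec, Matrix.vecMulVec_mul, Matrix.star_mulVec]

theorem ptrace_ptrace_ketbra {ι : Type*} [Fintype ι] (χ : (ι × E) × A' → ℂ) (i j : ι) :
    ptrace (ptrace (ketbra χ)) i j = (bitComp χ i * (bitComp χ j)ᴴ).trace := by
  simp [ptrace, ketbra, Matrix.vecMulVec_apply, Matrix.trace, Matrix.mul_apply, bitComp]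

theorem dotProduct_ptrace_ptrace_ketbra {ι : Type*} [Fintype ι] (χ : (ι × E) × A' → ℂ)
    (v : ι → ℂ) :
    star v ⬝ᵥ (ptrace (ptrace (ketbra χ)) *ᵥ v) =
      ((∑ i, star (v i) • bitComp χ i) * (∑ i, star (v i) • bitComp χ i)ᴴ).trace := by
  simp only [dotProduct, Matrix.mulVec, ptrace_ptrace_ketbra, Matrix.conjTranspose_sum,
    Matrix.conjTranspose_smul, star_star, Matrix.sum_mul, Matrix.mul_sum, Matrix.trace_sum, Finset.mul_sum,
    Matrix.smul_mul, Matrix.mul_smul, Matrix.trace_smul, smul_eq_mul, Pi.star_apply]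
  rw [Finset.sum_comm]
  refine Finset.sum_congr rfl fun i _ => Finset.sum_congr rfl fun j _ => ?_
  ring

/-- A vector of `E ⊗ A'` is read as a matrix, so an ancilla operator acts on it from the right
through its transpose. -/
theorem bitComp_kronecker_mulVec {ι : Type*} [Fintype ι] [DecidableEq E] (B : Matrix ι ι ℂ)
    (C : Matrix A' A' ℂ) (Ψ : (ι × E) × A' → ℂ) (i : ι) :
    bitComp (((B ⊗ₖ (1 : Matrix E E ℂ)) ⊗ₖ C) *ᵥ Ψ) i = ∑ b, B i b • (bitComp Ψ b * Cᵀ) := by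
  ext e α
  simp only [bitComp, Matrix.of_apply, Matrix.mulVec, dotProduct, Fintype.sum_prod_type,
    Matrix.kronecker_apply, Matrix.one_apply, Matrix.sum_apply, Matrix.smul_apply,
    Matrix.mul_apply, Matrix.transpose_apply, smul_eq_mul, Finset.mul_sum]
  refine Finset.sum_congr rfl fun b _ => ?_
  rw [Finset.sum_eq_single e]
  · refine Finset.sum_congr rfl fun β _ => ?_
    simp
    ring
  · intro f _ hf
    simp [hf.symm]
  · simp

/-- The flip `Z^e` turns the bra of phase `0` into that of phase `e`. The syndrome projection then
keeps it only if `s` is the syndrome of `e`. -/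
theorem sum_phaseKet_smul_bitComp [DecidableEq E] (h : Matrix (Fin r) (Fin n) (ZMod 2))
    (s : Bits r) (e : Bits n) (C : Matrix A' A' ℂ) (Ψ : (Bits n × E) × A' → ℂ) :
    ∑ i, star (phaseKet 0 i) •
        bitComp ((((pauliZ e * syndromeProj h s) ⊗ₖ (1 : Matrix E E ℂ)) ⊗ₖ C) *ᵥ Ψ) i =
      (if h *ᵥ e = s then 1 else 0 : ℂ) • (phaseComp Ψ e * Cᵀ) := by
  have hv : phaseKet 0 ᵥ* (pauliZ e * syndromeProj h s) =
      (if h *ᵥ e = s then 1 else 0 : ℂ) • phaseKet e := by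
    rw [← Matrix.vecMul_vecMul, phaseKet_vecMul_pauliZ, phaseKet_vecMul_syndromeProj]
  have hs (i : Bits n) : star (phaseKet 0 i) = phaseKet 0 i := congrFun (star_phaseKet 0) i
  simp only [bitComp_kronecker_mulVec, Finset.smul_sum, smul_smul, hs]
  rw [Finset.sum_comm]
  simp only [← Finset.sum_smul]
  have hb (b : Bits n) : ∑ i, phaseKet 0 i * (pauliZ e * syndromeProj h s) i b =
      (if h *ᵥ e = s then 1 else 0 : ℂ) * phaseKet e b := congrFun hv b
  simp only [hb, phaseComp, Matrix.sum_mul, Finset.smul_sum, smul_smul, Matrix.smul_mul]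

theorem trace_pec [DecidableEq E] [DecidableEq A'] (h : Matrix (Fin r) (Fin n) (ZMod 2))
    (M : Bits r → Bits n → Matrix A' A' ℂ) (hM : ∀ s, IsMeasurement (M s))
    (ρ : Matrix ((Bits n × E) × A') ((Bits n × E) × A') ℂ) :
    (pec h M ρ).trace = ρ.trace := by
  have hK (s : Bits r) (e : Bits n) :
      (((pauliZ e * syndromeProj h s) ⊗ₖ (1 : Matrix E E ℂ)) ⊗ₖ M s e)ᴴ *
        (((pauliZ e * syndromeProj h s) ⊗ₖ (1 : Matrix E E ℂ)) ⊗ₖ M s e) =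
      (((syndromeProj h s)ᴴ * syndromeProj h s) ⊗ₖ (1 : Matrix E E ℂ)) ⊗ₖ
        ((M s e)ᴴ * M s e) := by
    rw [Matrix.conjTranspose_kronecker, Matrix.conjTranspose_kronecker,
      ← Matrix.mul_kronecker_mul, ← Matrix.mul_kronecker_mul, Matrix.conjTranspose_mul,
      Matrix.mul_assoc, ← Matrix.mul_assoc (pauliZ e)ᴴ, pauliZ_conjTranspose_mul_self,
      Matrix.one_mul, Matrix.conjTranspose_one, Matrix.one_mul]
  have hsum (B : Matrix (Bits n × E) (Bits n × E) ℂ) (C : Bits n → Matrix A' A' ℂ) :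
      ∑ e, B ⊗ₖ C e = B ⊗ₖ ∑ e, C e := by
    ext i j
    simp [Matrix.sum_apply, Finset.mul_sum]
  have hsum' (B : Bits r → Matrix (Bits n) (Bits n) ℂ) :
      ∑ s, (B s ⊗ₖ (1 : Matrix E E ℂ)) ⊗ₖ (1 : Matrix A' A' ℂ) =
        ((∑ s, B s) ⊗ₖ (1 : Matrix E E ℂ)) ⊗ₖ (1 : Matrix A' A' ℂ) := by
    ext i j
    simp [Matrix.sum_apply, Finset.sum_mul]
  simp only [pec, Matrix.trace_sum]
  simp only [Matrix.trace_mul_cycle _ ρ, hK]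
  simp only [← Matrix.trace_sum, ← Finset.sum_mul, hsum]
  have hM' (s : Bits r) : ∑ e, (M s e)ᴴ * M s e = 1 := hM s
  simp only [hM', hsum', sum_syndromeProj_conjTranspose_mul_self, Matrix.one_kronecker_one,
    Matrix.one_mul]

/-- The correction preserves the trace, and in the success weight each `e` survives for the single
syndrome `h *ᵥ e`. -/
theorem phaseErrorProb_pec [DecidableEq E] [DecidableEq A']
    (h : Matrix (Fin r) (Fin n) (ZMod 2))
    (M : Bits r → Bits n → Matrix A' A' ℂ) (hM : ∀ s, IsMeasurement (M s))
    {Ψ : (Bits n × E) × A' → ℂ} {ρ : Matrix (Bits n × E) (Bits n × E) ℂ}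
    (hΨ : IsPurification Ψ ρ) :
    phaseErrorProb (ptrace (ptrace (pec h M (ketbra Ψ)))) =
      ρ.trace.re - ∑ e, (phaseComp Ψ e * (M (h *ᵥ e) e)ᵀ *
        (phaseComp Ψ e * (M (h *ᵥ e) e)ᵀ)ᴴ).trace.re := by
  rw [phaseErrorProb, trace_ptrace, trace_ptrace, trace_pec h M hM, ← trace_ptrace, hΨ,
    Complex.sub_re]
  congr 1
  simp only [pec, mul_ketbra_mul_conjTranspose, ptrace_sum, Matrix.sum_mulVec, dotProduct_sum,
    dotProduct_ptrace_ptrace_ketbra, sum_phaseKet_smul_bitComp, Complex.re_sum]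
  rw [Finset.sum_comm]
  refine Finset.sum_congr rfl fun e _ => ?_
  rw [Finset.sum_eq_single (h *ᵥ e)]
  · simp
  · intro s _ hs
    simp [hs.symm]
  · simp

end Correction

theorem bitComp_mul_conjTranspose {n : ℕ} {E A' : Type*} [Fintype A']
    {Ψ : (Bits n × E) × A' → ℂ} {ρ : Matrix (Bits n × E) (Bits n × E) ℂ}
    (hΨ : IsPurification Ψ ρ) {q : Bits n → Matrix E E ℂ}
    (hq : ρ = ∑ a, Matrix.single a a (1 : ℂ) ⊗ₖ q a) (a b : Bits n) :
    bitComp Ψ a * (bitComp Ψ b)ᴴ = if a = b then q a else 0 := by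
  ext e f
  have h1 : (bitComp Ψ a * (bitComp Ψ b)ᴴ) e f = ρ (a, e) (b, f) := by
    rw [← hΨ]
    simp [bitComp, Matrix.mul_apply, ptrace, ketbra, Matrix.vecMulVec_apply]
  rw [h1, hq, Matrix.sum_apply]
  by_cases hab : a = b
  · subst hab
    rw [Finset.sum_eq_single a]
    · simp
    · intro c _ hc
      simp [hc]
    · simp
  · rw [if_neg hab]
    refine Finset.sum_eq_zero fun c _ => ?_
    rw [Matrix.kronecker_apply, Matrix.single_apply_of_ne, zero_mul]
    rintro ⟨rfl, rfl⟩
    exact hab rfl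

/-! ### Cosets of the code `(ker g)^⊥`. -/

section Code

variable {n m : ℕ}

/-- The transpose of a linear map of bit strings. -/
def dualMap (g : Bits n →ₗ[ZMod 2] Bits m) (y : Bits m) : Bits n :=
  fun i => y ⬝ᵥ g (Pi.single i 1)

theorem dualMap_dotProduct (g : Bits n →ₗ[ZMod 2] Bits m) (y : Bits m) (a : Bits n) :
    dualMap g y ⬝ᵥ a = y ⬝ᵥ g a := by
  conv_rhs => rw [pi_eq_sum_univ' a]
  simp only [map_sum, dotProduct_sum, map_smul, dotProduct_smul]
  rw [dotProduct]
  refine Finset.sum_congr rfl fun i _ => ?_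
  rw [smul_eq_mul, mul_comm]
  rfl

theorem dualMap_injective {g : Bits n →ₗ[ZMod 2] Bits m} (hg : Function.Surjective g) :
    Function.Injective (dualMap g) := by
  intro y y' hy
  refine dotProduct_eq _ _ fun k => ?_
  obtain ⟨a, rfl⟩ := hg k
  rw [← dualMap_dotProduct, ← dualMap_dotProduct, hy]

/-- For a linear section `σ` of `g`, the string `a - σ (g a)` lies in `ker g` and is therefore
orthogonal to `x`. -/
theorem exists_dualMap_eq {g : Bits n →ₗ[ZMod 2] Bits m} (hg : Function.Surjective g)
    {x : Bits n} (hx : x ∈ code g) : ∃ y, dualMap g y = x := by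
  obtain ⟨σ, hσ⟩ := LinearMap.exists_rightInverse_of_surjective g (LinearMap.range_eq_top.mpr hg)
  refine ⟨dualMap σ x, dotProduct_eq _ _ fun a => ?_⟩
  rw [dualMap_dotProduct, dualMap_dotProduct, ← sub_eq_zero, ← dotProduct_sub]
  refine hx _ ?_
  have := LinearMap.congr_fun hσ (g a)
  simp only [LinearMap.comp_apply, LinearMap.id_apply] at this
  rw [map_sub, this, sub_self]

/-- A coset of the code of `g` is parametrized by the transpose of `g`. -/
theorem sum_syndrome_eq {r : ℕ} {N : Type*} [AddCommMonoid N] {g : Bits n →ₗ[ZMod 2] Bits m}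
    (hg : Function.Surjective g) {h : Matrix (Fin r) (Fin n) (ZMod 2)}
    (hh : IsCheckMatrix h (code g)) (x : Bits n) (F : Bits n → N) :
    ∑ e with h *ᵥ e = h *ᵥ x, F e = ∑ y, F (x + dualMap g y) := by
  symm
  refine Finset.sum_bij (fun y _ => x + dualMap g y) ?_ ?_ ?_ fun _ _ => rfl
  · intro y _
    have : h *ᵥ dualMap g y = 0 := (hh _).mp fun a ha => by
      rw [dualMap_dotProduct, ha, dotProduct_zero]
    simp [Matrix.mulVec_add, this]
  · intro y _ y' _ hy
    exact dualMap_injective hg (add_left_cancel hy)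
  · intro e he
    have he' : e - x ∈ code g := (hh _).mpr (by
      rw [Matrix.mulVec_sub, (Finset.mem_filter.mp he).2, sub_self])
    obtain ⟨y, hy⟩ := exists_dualMap_eq hg he'
    exact ⟨y, Finset.mem_univ _, by rw [hy, add_sub_cancel]⟩

end Code

/-! ### The decoding operators and their completeness relation. -/

section Decoder

variable {n m : ℕ} {E A' : Type*} [Fintype E] [DecidableEq E] [Fintype A']

/-- The power `S^(k/4)`. -/
def rootPow {S : Matrix E E ℂ} (hS : S.PosSemidef) (k : ℕ) : Matrix E E ℂ :=
  hfun hS.1 fun x => fourthRoot x ^ k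

/-- The inverse of `S^(1/4)` on the support of `S`. -/
def rootInv {S : Matrix E E ℂ} (hS : S.PosSemidef) : Matrix E E ℂ :=
  hfun hS.1 fun x => (fourthRoot x)⁻¹

/-- The support projection of `S`. -/
def supp {S : Matrix E E ℂ} (hS : S.PosSemidef) : Matrix E E ℂ :=
  hfun hS.1 fun x => fourthRoot x * (fourthRoot x)⁻¹

theorem fourthRoot_eq_zero {x : ℝ} (hx : 0 ≤ x) (h : fourthRoot x = 0) : x = 0 := by
  rw [← fourthRoot_pow_four hx, h]
  norm_num

theorem supp_isHermitian {S : Matrix E E ℂ} (hS : S.PosSemidef) : (supp hS)ᴴ = supp hS :=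
  hfun_isHermitian _ _

theorem rootInv_isHermitian {S : Matrix E E ℂ} (hS : S.PosSemidef) :
    (rootInv hS)ᴴ = rootInv hS := hfun_isHermitian _ _

theorem rootPow_isHermitian {S : Matrix E E ℂ} (hS : S.PosSemidef) (k : ℕ) :
    (rootPow hS k)ᴴ = rootPow hS k := hfun_isHermitian _ _

theorem rootPow_mul_rootPow {S : Matrix E E ℂ} (hS : S.PosSemidef) (k l : ℕ) :
    rootPow hS k * rootPow hS l = rootPow hS (k + l) := by
  simp only [rootPow, hfun_mul, pow_add]

theorem rootPow_four {S : Matrix E E ℂ} (hS : S.PosSemidef) : rootPow hS 4 = S := by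
  rw [rootPow, hfun_congr hS (g := fun x => x) fun x hx => fourthRoot_pow_four hx, hfun_id]

theorem rootInv_mul_rootPow_one {S : Matrix E E ℂ} (hS : S.PosSemidef) :
    rootInv hS * rootPow hS 1 = supp hS := by
  simp only [rootPow, rootInv, supp, hfun_mul, pow_one, mul_comm]

theorem supp_mul_self {S : Matrix E E ℂ} (hS : S.PosSemidef) : supp hS * S = S := by
  suffices h : supp hS * hfun hS.1 (fun x => x) = hfun hS.1 (fun x => x) by
    rwa [hfun_id] at h
  rw [supp, hfun_mul]
  refine hfun_congr hS fun x hx => ?_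
  by_cases h : fourthRoot x = 0
  · rw [fourthRoot_eq_zero hx h, mul_zero]
  · rw [mul_inv_cancel₀ h, one_mul]

/-- Every summand of a sum of squares has its range in the support of the sum. -/
theorem supp_mul_of_sum {ι : Type*} [Fintype ι] {S : Matrix E E ℂ} (hS : S.PosSemidef)
    {T : ι → Matrix E A' ℂ} (hT : ∑ a, T a * (T a)ᴴ = S) (a : ι) : supp hS * T a = T a := by
  -- The nonnegative traces of the compressions to the kernel of `S` add up to `Tr (1 - supp) S (1 -
  -- supp) = 0`, so each of them vanishes.
  have hsum : ∑ a, (((1 - supp hS) * T a) * ((1 - supp hS) * T a)ᴴ).trace = 0 := by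
    have : ∑ a, (((1 - supp hS) * T a) * ((1 - supp hS) * T a)ᴴ).trace =
        ((1 - supp hS) * (∑ a, T a * (T a)ᴴ) * (1 - supp hS)ᴴ).trace := by
      rw [Finset.mul_sum, Finset.sum_mul, Matrix.trace_sum]
      simp only [Matrix.conjTranspose_mul, Matrix.mul_assoc]
    rw [this, hT, Matrix.sub_mul, Matrix.one_mul, supp_mul_self, sub_self, Matrix.zero_mul,
      Matrix.trace_zero]
  have h0 := (Finset.sum_eq_zero_iff_of_nonneg fun a _ =>
    (Matrix.posSemidef_self_mul_conjTranspose ((1 - supp hS) * T a)).trace_nonneg).mp hsum a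
      (Finset.mem_univ a)
  rw [Matrix.trace_mul_conjTranspose_self_eq_zero_iff, Matrix.sub_mul, Matrix.one_mul,
    sub_eq_zero] at h0
  exact h0.symm

/-- The operator `S^(-1/4) q S^(-1/4)`. -/
def sandwich {S : Matrix E E ℂ} (hS : S.PosSemidef) (q : Matrix E E ℂ) : Matrix E E ℂ :=
  rootInv hS * q * rootInv hS

theorem sandwich_posSemidef {S : Matrix E E ℂ} (hS : S.PosSemidef) {q : Matrix E E ℂ}
    (hq : q.PosSemidef) : (sandwich hS q).PosSemidef := by
  have := hq.mul_mul_conjTranspose_same (rootInv hS)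
  rwa [rootInv_isHermitian] at this

/-- The sum of the sandwiched operators over a fiber of the hash function. -/
def bin {S : Matrix E E ℂ} (hS : S.PosSemidef) (q : Bits n → Matrix E E ℂ)
    (g : Bits n → Bits m) (k : Bits m) : Matrix E E ℂ :=
  ∑ a with g a = k, sandwich hS (q a)

theorem bin_posSemidef {S : Matrix E E ℂ} (hS : S.PosSemidef) {q : Bits n → Matrix E E ℂ}
    (hq : ∀ a, (q a).PosSemidef) (g : Bits n → Bits m) (k : Bits m) :
    (bin hS q g k).PosSemidef :=
  Matrix.posSemidef_sum _ fun a _ => sandwich_posSemidef hS (hq a)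

variable {S : Matrix E E ℂ} (hS : S.PosSemidef) {q : Bits n → Matrix E E ℂ}
  (hq : ∀ a, (q a).PosSemidef) (g : Bits n → Bits m) (T : Bits n → Matrix E A' ℂ)

/-- The inverse square root of the `k`-th bin. -/
def binInv (k : Bits m) : Matrix E E ℂ :=
  hfun (bin_posSemidef hS hq g k).1 fun x => (Real.sqrt x)⁻¹

/-- The bit components after renormalization. -/
def decoderComp (a : Bits n) : Matrix E A' ℂ := binInv hS hq g (g a) * rootInv hS * T a

/-- The decoding operator of the phase pattern `e`. -/
def decoder (e : Bits n) : Matrix E A' ℂ :=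
  phaseNorm m • ∑ a, sgn (e ⬝ᵥ a) • decoderComp hS hq g T a

theorem binInv_isHermitian (k : Bits m) : (binInv hS hq g k)ᴴ = binInv hS hq g k :=
  hfun_isHermitian _ _

theorem binInv_mul_bin (k : Bits m) : binInv hS hq g k * bin hS q g k =
    hfun (bin_posSemidef hS hq g k).1 Real.sqrt := by
  conv_lhs => enter [2]; rw [← hfun_id (bin_posSemidef hS hq g k).1]
  rw [binInv, hfun_mul]
  refine hfun_congr (bin_posSemidef hS hq g k) fun x hx => ?_
  rw [inv_mul_eq_div, Real.div_sqrt]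

/-- The first three factors form the support projection of the bin, since the inverse of `0` is `0`.
-/
theorem binInv_mul_bin_mul_binInv_mul_binInv (k : Bits m) :
    binInv hS hq g k * bin hS q g k * binInv hS hq g k * binInv hS hq g k =
      binInv hS hq g k := by
  rw [binInv_mul_bin, binInv, hfun_mul, hfun_mul]
  refine hfun_congr (bin_posSemidef hS hq g k) fun x hx => ?_
  by_cases h : Real.sqrt x = 0
  · simp [h]
  · rw [mul_inv_cancel₀ h, one_mul]

/-- The operator `decoderComp` summed with signs over a fiber. -/
def fiberComp (w : Bits n → ℂ) (k : Bits m) : Matrix E A' ℂ :=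
  ∑ a with g a = k, w a • decoderComp hS hq g T a

variable {T} (hT : ∀ a b, T a * (T b)ᴴ = if a = b then q a else 0)
include hT

theorem decoderComp_mul_conjTranspose (a b : Bits n) :
    decoderComp hS hq g T a * (T b)ᴴ =
      if a = b then binInv hS hq g (g a) * rootInv hS * q a else 0 := by
  rw [decoderComp, Matrix.mul_assoc, hT]
  split_ifs <;> simp

theorem decoderComp_mul_decoderComp_conjTranspose (a b : Bits n) :
    decoderComp hS hq g T a * (decoderComp hS hq g T b)ᴴ =
      if a = b then binInv hS hq g (g a) * sandwich hS (q a) * binInv hS hq g (g a) else 0 := by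
  have : (decoderComp hS hq g T b)ᴴ = (T b)ᴴ * (rootInv hS * binInv hS hq g (g b)) := by
    rw [decoderComp, Matrix.conjTranspose_mul, Matrix.conjTranspose_mul, rootInv_isHermitian,
      binInv_isHermitian]
  rw [this, ← Matrix.mul_assoc, decoderComp_mul_conjTranspose hS hq g hT]
  split_ifs with hab
  · subst hab
    simp only [sandwich, Matrix.mul_assoc]
  · simp

theorem fiberComp_mul_conjTranspose {w : Bits n → ℂ} (hw : ∀ a, w a * star (w a) = 1)
    (k l : Bits m) :
    fiberComp hS hq g T w k * (fiberComp hS hq g T w l)ᴴ =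
      if k = l then binInv hS hq g k * bin hS q g k * binInv hS hq g k else 0 := by
  simp only [fiberComp, Matrix.conjTranspose_sum, Matrix.conjTranspose_smul, Matrix.sum_mul,
    Matrix.mul_sum, Matrix.smul_mul, Matrix.mul_smul,
    decoderComp_mul_decoderComp_conjTranspose hS hq g hT]
  split_ifs with hkl
  · subst hkl
    rw [bin, Matrix.mul_sum, Matrix.sum_mul]
    refine Finset.sum_congr rfl fun a ha => ?_
    rw [Finset.sum_eq_single_of_mem a ha]
    · rw [if_pos rfl, smul_smul, mul_comm, hw, one_smul,
        (Finset.mem_filter.mp ha).2]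
    · intro b _ hb
      simp [hb]
  · refine Finset.sum_eq_zero fun b hb => ?_
    rw [Finset.sum_eq_zero, smul_zero]
    intro a ha
    have hab : a ≠ b := by
      rintro rfl
      exact hkl ((Finset.mem_filter.mp ha).2.symm.trans (Finset.mem_filter.mp hb).2)
    simp [hab]

/-- The `fiberComp` operators are partial isometries with mutually orthogonal initial spaces, so the
sum is an orthogonal projection. -/
theorem one_sub_sum_fiberComp_posSemidef [DecidableEq A'] {w : Bits n → ℂ}
    (hw : ∀ a, w a * star (w a) = 1) :
    (1 - ∑ k, (fiberComp hS hq g T w k)ᴴ * fiberComp hS hq g T w k).PosSemidef := by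
  set P := ∑ k, (fiberComp hS hq g T w k)ᴴ * fiberComp hS hq g T w k with hP
  have hherm : Pᴴ = P := by
    simp [hP, Matrix.conjTranspose_sum, Matrix.conjTranspose_mul]
  have habs (k : Bits m) : binInv hS hq g k * bin hS q g k * binInv hS hq g k *
      fiberComp hS hq g T w k = fiberComp hS hq g T w k := by
    rw [fiberComp, Matrix.mul_sum]
    refine Finset.sum_congr rfl fun a ha => ?_
    rw [Matrix.mul_smul, decoderComp, (Finset.mem_filter.mp ha).2]
    simp only [← Matrix.mul_assoc]
    rw [binInv_mul_bin_mul_binInv_mul_binInv]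
  have hidem : P * P = P := by
    rw [hP, Finset.sum_mul_sum]
    refine Finset.sum_congr rfl fun k _ => ?_
    rw [Finset.sum_eq_single_of_mem k (Finset.mem_univ k)]
    · rw [Matrix.mul_assoc, ← Matrix.mul_assoc (fiberComp hS hq g T w k),
        fiberComp_mul_conjTranspose hS hq g hT hw, if_pos rfl, habs]
    · intro l _ hl
      rw [Matrix.mul_assoc, ← Matrix.mul_assoc (fiberComp hS hq g T w k),
        fiberComp_mul_conjTranspose hS hq g hT hw, if_neg hl.symm, Matrix.zero_mul,
        Matrix.mul_zero]
  have : 1 - P = (1 - P)ᴴ * (1 - P) := by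
    rw [Matrix.conjTranspose_sub, Matrix.conjTranspose_one, hherm, Matrix.mul_sub, Matrix.sub_mul,
      Matrix.sub_mul, hidem]
    simp
  rw [this]
  exact Matrix.posSemidef_conjTranspose_mul_self _

end Decoder

/-- Parseval's identity for operator-valued functions. -/
theorem sum_fourier_conjTranspose_mul_self {m : ℕ} {E A' : Type*} [Fintype E]
    (W : Bits m → Matrix E A' ℂ) :
    ∑ y, (phaseNorm m • ∑ k, sgn (y ⬝ᵥ k) • W k)ᴴ * (phaseNorm m • ∑ k, sgn (y ⬝ᵥ k) • W k) =
      ∑ k, (W k)ᴴ * W k := by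
  have h1 (y : Bits m) :
      (phaseNorm m • ∑ k, sgn (y ⬝ᵥ k) • W k)ᴴ * (phaseNorm m • ∑ k, sgn (y ⬝ᵥ k) • W k) =
        ∑ k, ∑ l, (((2 : ℂ) ^ m)⁻¹ * sgn (y ⬝ᵥ (k + l))) • ((W k)ᴴ * W l) := by
    simp only [Matrix.conjTranspose_smul, Matrix.conjTranspose_sum, Matrix.smul_mul,
      Matrix.mul_smul, smul_smul, Matrix.sum_mul, Matrix.mul_sum, Finset.smul_sum]
    rw [Finset.sum_comm]
    refine Finset.sum_congr rfl fun k _ => Finset.sum_congr rfl fun l _ => ?_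
    rw [dotProduct_add, sgn_add, ← phaseNorm_mul_self, star_mul', star_sgn, star_phaseNorm]
    congr 1
    ring
  simp only [h1]
  rw [Finset.sum_comm]
  refine Finset.sum_congr rfl fun k _ => ?_
  rw [Finset.sum_comm]
  simp only [← Finset.sum_smul, ← Finset.mul_sum, sum_sgn_dotProduct, add_eq_zero_iff_bits]
  rw [Finset.sum_eq_single_of_mem k (Finset.mem_univ k)]
  · simp
  · intro l _ hl
    simp [hl.symm]

/-! ### The decoder restricted to one syndrome. -/

section Coset

variable {n m r : ℕ} {E A' : Type*} [Fintype E] [DecidableEq E]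
  {S : Matrix E E ℂ} (hS : S.PosSemidef) {q : Bits n → Matrix E E ℂ}
  (hq : ∀ a, (q a).PosSemidef) (T : Bits n → Matrix E A' ℂ)

/-- Along a coset the sign changes by `(-1)^(y·g a)`, which depends only on the bin of `a`. This is
what makes Parseval over the bins applicable. -/
theorem decoder_add_dualMap (g : Bits n →ₗ[ZMod 2] Bits m) (x : Bits n) (y : Bits m) :
    decoder hS hq g T (x + dualMap g y) =
      phaseNorm m • ∑ k, sgn (y ⬝ᵥ k) • fiberComp hS hq g T (fun a => sgn (x ⬝ᵥ a)) k := by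
  rw [decoder, ← Finset.sum_fiberwise (s := Finset.univ) (g := g)]
  congr 1
  refine Finset.sum_congr rfl fun k _ => ?_
  rw [fiberComp, Finset.smul_sum]
  refine Finset.sum_congr rfl fun a ha => ?_
  rw [add_dotProduct, sgn_add, dualMap_dotProduct, (Finset.mem_filter.mp ha).2, smul_smul,
    mul_comm]

variable [Fintype A'] [DecidableEq A'] {T} (hT : ∀ a b, T a * (T b)ᴴ = if a = b then q a else 0)
include hT

theorem one_sub_sum_decoder_posSemidef {g : Bits n →ₗ[ZMod 2] Bits m}
    (hg : Function.Surjective g) {h : Matrix (Fin r) (Fin n) (ZMod 2)}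
    (hh : IsCheckMatrix h (code g)) (s : Bits r) :
    (1 - ∑ e with h *ᵥ e = s,
      (decoder hS hq g T e)ᴴ * decoder hS hq g T e).PosSemidef := by
  by_cases hs : ∃ x, h *ᵥ x = s
  · obtain ⟨x, rfl⟩ := hs
    rw [sum_syndrome_eq hg hh]
    simp only [decoder_add_dualMap]
    rw [sum_fourier_conjTranspose_mul_self]
    exact one_sub_sum_fiberComp_posSemidef hS hq g hT fun a => by rw [star_sgn, sgn_mul_self]
  -- A syndrome that no string attains leaves an empty sum.
  · have : (Finset.univ.filter fun e => h *ᵥ e = s) = ∅ := by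
      ext e
      simpa using fun he => hs ⟨e, he⟩
    rw [this, Finset.sum_empty, sub_zero]
    exact Matrix.PosSemidef.one

end Coset

/-! ### Lower bound for the success weight. -/

section Success

variable {n m r : ℕ} {E A' : Type*} [Fintype E] [DecidableEq E] [Fintype A']
  {S : Matrix E E ℂ} (hS : S.PosSemidef) {q : Bits n → Matrix E E ℂ}

theorem sandwich_sum (s : Finset (Bits n)) :
    sandwich hS (∑ a ∈ s, q a) = ∑ a ∈ s, sandwich hS (q a) := by
  simp only [sandwich, Finset.mul_sum, Finset.sum_mul]

theorem sandwich_self : sandwich hS S = rootPow hS 2 := by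
  have : rootInv hS * rootPow hS 4 * rootInv hS = rootPow hS 2 := by
    simp only [rootInv, rootPow, hfun_mul]
    congr 1
    ext x
    by_cases h : fourthRoot x = 0
    · simp [h]
    · field_simp
  rwa [rootPow_four] at this

theorem sum_sandwich (hsum : ∑ a, q a = S) : ∑ a, sandwich hS (q a) = rootPow hS 2 := by
  rw [← sandwich_sum, hsum, sandwich_self]

theorem sum_bin (hsum : ∑ a, q a = S) (g : Bits n → Bits m) :
    ∑ k, bin hS q g k = rootPow hS 2 := by
  rw [← sum_sandwich hS hsum]
  exact Finset.sum_fiberwise _ _ _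

theorem rootPow_two_mul_self : rootPow hS 2 * rootPow hS 2 = S := by
  rw [rootPow_mul_rootPow, rootPow_four]

variable (hq : ∀ a, (q a).PosSemidef) (g : Bits n → Bits m)

/-- The sum of the square roots of the bins, times `S^(1/4)`. -/
def rootSum : Matrix E E ℂ :=
  ∑ k, hfun (bin_posSemidef hS hq g k).1 Real.sqrt * rootPow hS 1

/-- With `c = 2^(m/2)`, expanding the squared Hilbert–Schmidt norm of `c⁻¹ Y - S^(1/2)` bounds the
quadratic term below by a term linear in `Y`. That term is `∑ Tr R_k^(1/2) S^(3/4)`, to which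
`trace_sqrt_mul_fourthRoot_cube` applies bin by bin. -/
theorem le_trace_rootSum (hsum : ∑ a, q a = S) :
    2 * S.trace.re - 2 ^ m * ∑ k, (bin hS q g k * bin hS q g k).trace.re ≤
      ((2 : ℝ) ^ m)⁻¹ * ((rootSum hS hq g)ᴴ * rootSum hS hq g).trace.re := by
  have hc : 0 < Real.sqrt (2 ^ m) := Real.sqrt_pos.mpr (by positivity)
  have hc2 : Real.sqrt (2 ^ m) ^ 2 = 2 ^ m := Real.sq_sqrt (by positivity)
  set c := Real.sqrt (2 ^ m)
  set Y := rootSum hS hq g with hY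
  have hpos : 0 ≤ (((((c⁻¹ : ℝ) : ℂ) • Y - rootPow hS 2)ᴴ) *
      (((c⁻¹ : ℝ) : ℂ) • Y - rootPow hS 2)).trace.re :=
    (Complex.le_def.mp (Matrix.posSemidef_conjTranspose_mul_self _).trace_nonneg).1
  have hconj : (Yᴴ * rootPow hS 2).trace.re = (rootPow hS 2 * Y).trace.re := by
    have : Yᴴ * rootPow hS 2 = (rootPow hS 2 * Y)ᴴ := by
      rw [Matrix.conjTranspose_mul, rootPow_isHermitian]
    rw [this, Matrix.trace_conjTranspose]
    exact Complex.conj_re _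
  have hexp : (((((c⁻¹ : ℝ) : ℂ) • Y - rootPow hS 2)ᴴ) *
      (((c⁻¹ : ℝ) : ℂ) • Y - rootPow hS 2)).trace.re =
      c⁻¹ ^ 2 * (Yᴴ * Y).trace.re - 2 * c⁻¹ * (rootPow hS 2 * Y).trace.re + S.trace.re := by
    rw [Matrix.conjTranspose_sub, Matrix.conjTranspose_smul, rootPow_isHermitian,
      Complex.star_def, Complex.conj_ofReal, Matrix.sub_mul, Matrix.mul_sub, Matrix.mul_sub,
      rootPow_two_mul_self]
    simp only [Matrix.smul_mul, Matrix.mul_smul, smul_smul, Matrix.trace_sub, Matrix.trace_smul,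
      smul_eq_mul, Complex.sub_re, ← Complex.ofReal_mul, Complex.re_ofReal_mul, hconj]
    ring
  have hYtr : (rootPow hS 2 * Y).trace.re =
      ∑ k, (hfun (bin_posSemidef hS hq g k).1 Real.sqrt * rootPow hS 3).trace.re := by
    rw [hY, rootSum, Matrix.mul_sum, Matrix.trace_sum, Complex.re_sum]
    refine Finset.sum_congr rfl fun k _ => ?_
    rw [Matrix.trace_mul_comm, Matrix.mul_assoc, rootPow_mul_rootPow]
  have hbin := Finset.sum_le_sum fun k (_ : k ∈ Finset.univ) =>
    trace_sqrt_mul_fourthRoot_cube (bin_posSemidef hS hq g k) hS hc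
  have hR : ∑ k, (bin hS q g k * hfun hS.1 fun x => fourthRoot x ^ 2).trace.re = S.trace.re := by
    rw [← Complex.re_sum, ← Matrix.trace_sum, ← Finset.sum_mul, sum_bin hS hsum]
    exact congrArg (fun M : Matrix E E ℂ => M.trace.re) (rootPow_two_mul_self hS)
  rw [Finset.sum_sub_distrib, ← Finset.mul_sum, ← Finset.mul_sum, ← Finset.mul_sum, hR, hc2]
    at hbin
  rw [hexp, hYtr] at hpos
  have e3 : ∀ k, hfun (bin_posSemidef hS hq g k).1 Real.sqrt * rootPow hS 3 =
      hfun (bin_posSemidef hS hq g k).1 Real.sqrt * hfun hS.1 (fun x => fourthRoot x ^ 3) :=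
    fun _ => rfl
  simp only [e3] at hpos
  rw [inv_pow, hc2] at hpos
  linarith

variable {T : Bits n → Matrix E A' ℂ} (hT : ∀ a b, T a * (T b)ᴴ = if a = b then q a else 0)
include hT

/-- `S` may be singular. The identity holds because the support of each `q a` lies in that of `S`.
-/
theorem rootInv_mul_eq_sandwich_mul (hsum : ∑ a, q a = S) (a : Bits n) :
    rootInv hS * q a = sandwich hS (q a) * rootPow hS 1 := by
  have hTq (a : Bits n) : T a * (T a)ᴴ = q a := by rw [hT, if_pos rfl]
  have h1 : supp hS * T a = T a := supp_mul_of_sum hS (by simpa only [hTq] using hsum) a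
  have h2 : (T a)ᴴ * supp hS = (T a)ᴴ := by
    conv_rhs => rw [← h1, Matrix.conjTranspose_mul, supp_isHermitian]
  rw [sandwich, Matrix.mul_assoc _ (rootInv hS), rootInv_mul_rootPow_one, Matrix.mul_assoc,
    ← hTq, Matrix.mul_assoc, h2]

/-- Only the terms with equal indices survive, and there the two signs multiply to 1. Hence the
amplitude is independent of `e`. -/
theorem decoder_mul_phase_conjTranspose (hsum : ∑ a, q a = S) (e : Bits n) :
    decoder hS hq g T e * (∑ a, phaseKet e a • T a)ᴴ =
      (phaseNorm m * phaseNorm n) • rootSum hS hq g := by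
  have h1 : decoder hS hq g T e * (∑ a, phaseKet e a • T a)ᴴ =
      (phaseNorm m * phaseNorm n) • ∑ a, binInv hS hq g (g a) * rootInv hS * q a := by
    simp only [decoder, Matrix.conjTranspose_sum, Matrix.conjTranspose_smul, Matrix.smul_mul,
      Matrix.sum_mul, Matrix.mul_sum, Matrix.mul_smul,
      decoderComp_mul_conjTranspose hS hq g hT, Finset.smul_sum]
    refine Finset.sum_congr rfl fun a _ => ?_
    rw [Finset.sum_eq_single_of_mem a (Finset.mem_univ a)]
    · rw [if_pos rfl, phaseKet_apply, star_mul', star_phaseNorm, star_sgn, smul_smul, smul_smul]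
      congr 1
      linear_combination phaseNorm m * phaseNorm n * sgn_mul_self (e ⬝ᵥ a)
    · intro b _ hb
      simp [hb]
  rw [h1, rootSum, ← Finset.sum_fiberwise (s := Finset.univ) (g := g)]
  congr 1
  refine Finset.sum_congr rfl fun k _ => ?_
  rw [← binInv_mul_bin, bin, Matrix.mul_sum, Matrix.sum_mul]
  refine Finset.sum_congr rfl fun a ha => ?_
  rw [(Finset.mem_filter.mp ha).2, Matrix.mul_assoc,
    rootInv_mul_eq_sandwich_mul hS hT hsum, Matrix.mul_assoc]

/-- The success probability of the decoder. -/
theorem le_sum_trace_decoder (hsum : ∑ a, q a = S) :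
    2 * S.trace.re - 2 ^ m * ∑ k, (bin hS q g k * bin hS q g k).trace.re ≤
      ∑ e, ((∑ a, phaseKet e a • T a) * ((decoder hS hq g T e)ᴴ * decoder hS hq g T e) *
        (∑ a, phaseKet e a • T a)ᴴ).trace.re := by
  refine (le_trace_rootSum hS hq g hsum).trans (le_of_eq ?_)
  have (e : Bits n) :
      ((∑ a, phaseKet e a • T a) * ((decoder hS hq g T e)ᴴ * decoder hS hq g T e) *
        (∑ a, phaseKet e a • T a)ᴴ).trace.re =
      ((2 : ℝ) ^ n)⁻¹ * (((2 : ℝ) ^ m)⁻¹ *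
        ((rootSum hS hq g)ᴴ * rootSum hS hq g).trace.re) := by
    have h1 : (∑ a, phaseKet e a • T a) * ((decoder hS hq g T e)ᴴ * decoder hS hq g T e) *
        (∑ a, phaseKet e a • T a)ᴴ =
        (decoder hS hq g T e * (∑ a, phaseKet e a • T a)ᴴ)ᴴ *
          (decoder hS hq g T e * (∑ a, phaseKet e a • T a)ᴴ) := by
      rw [Matrix.conjTranspose_mul, Matrix.conjTranspose_conjTranspose]
      simp only [Matrix.mul_assoc]
    have h2 : star (phaseNorm m * phaseNorm n) * (phaseNorm m * phaseNorm n) =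
        ((((2 : ℝ) ^ n)⁻¹ * ((2 : ℝ) ^ m)⁻¹ : ℝ) : ℂ) := by
      push_cast
      rw [← phaseNorm_mul_self, ← phaseNorm_mul_self, star_mul', star_phaseNorm, star_phaseNorm]
      ring
    rw [h1, decoder_mul_phase_conjTranspose hS hq g hT hsum, Matrix.conjTranspose_smul,
      Matrix.smul_mul, Matrix.mul_smul, smul_smul, h2, Matrix.trace_smul, smul_eq_mul,
      Complex.re_ofReal_mul, mul_assoc]
  simp only [this]
  -- The `2^n` equal terms cancel the normalization `2^(-n)` of the phase basis.
  rw [Finset.sum_const, Finset.card_univ, Fintype.card_fun, ZMod.card, Fintype.card_fin,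
    nsmul_eq_mul, ← mul_assoc]
  push_cast
  rw [mul_inv_cancel₀ (by positivity), one_mul]

end Success

/-! ### Completion of the decoder to a measurement. -/

section Measurement

variable {n r : ℕ} {E A' : Type*} [Fintype E] [Fintype A'] [DecidableEq A']

/-- A family of operators which are sub-normalized on every coset of a code is dominated by
measurements depending on the syndrome. -/
theorem exists_measurement_ge (h : Matrix (Fin r) (Fin n) (ZMod 2))
    (W : Bits n → Matrix E A' ℂ)
    (hW : ∀ s, (1 - ∑ e with h *ᵥ e = s, (W e)ᴴ * W e).PosSemidef) :
    ∃ M : Bits r → Bits n → Matrix A' A' ℂ, (∀ s, IsMeasurement (M s)) ∧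
      ∀ e (φ : Matrix E A' ℂ), (φ * ((W e)ᴴ * W e) * φᴴ).trace.re ≤
        (φ * (M (h *ᵥ e) e)ᵀ * (φ * (M (h *ᵥ e) e)ᵀ)ᴴ).trace.re := by
  set R : Bits r → Matrix A' A' ℂ := fun s => 1 - ∑ e with h *ᵥ e = s, (W e)ᴴ * W e with hR
  -- The missing part of the identity goes to outcome `0`, an arbitrary choice that can only
  -- increase the success weight.
  set N : Bits r → Bits n → Matrix A' A' ℂ := fun s e =>
    (if h *ᵥ e = s then (W e)ᴴ * W e else 0) + (if e = 0 then R s else 0) with hN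
  have hRe (s : Bits r) (e : Bits n) : (if e = 0 then R s else 0).PosSemidef := by
    split_ifs
    · exact hW s
    · exact Matrix.PosSemidef.zero
  have hNpos (s : Bits r) (e : Bits n) : (N s e).PosSemidef := by
    refine Matrix.PosSemidef.add ?_ (hRe s e)
    split_ifs
    · exact Matrix.posSemidef_conjTranspose_mul_self _
    · exact Matrix.PosSemidef.zero
  have hNsum (s : Bits r) : ∑ e, N s e = 1 := by
    simp only [hN, Finset.sum_add_distrib, Finset.sum_ite_eq', Finset.mem_univ, if_true]
    rw [← Finset.sum_filter]
    exact add_sub_cancel _ _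
  choose C hC hCC using fun s e => exists_conjTranspose_eq_mul_self_eq (hNpos s e)
  refine ⟨fun s e => (C s e)ᵀ, fun s => ?_, fun e φ => ?_⟩
  · have (e : Bits n) : ((C s e)ᵀ)ᴴ * (C s e)ᵀ = (N s e)ᵀ := by
      rw [show ((C s e)ᵀ)ᴴ = ((C s e)ᴴ)ᵀ from rfl, hC, ← Matrix.transpose_mul, hCC]
    simp only [IsMeasurement, this]
    rw [← Matrix.transpose_sum, hNsum, Matrix.transpose_one]
  · have h1 : φ * ((C (h *ᵥ e) e)ᵀ)ᵀ * (φ * ((C (h *ᵥ e) e)ᵀ)ᵀ)ᴴ =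
        φ * ((W e)ᴴ * W e) * φᴴ + φ * (if e = 0 then R (h *ᵥ e) else 0) * φᴴ := by
      rw [Matrix.transpose_transpose, Matrix.conjTranspose_mul, hC, Matrix.mul_assoc φ,
        ← Matrix.mul_assoc _ _ φᴴ, hCC, ← Matrix.mul_assoc, ← Matrix.add_mul, ← Matrix.mul_add]
      simp only [hN, if_true]
    rw [h1, Matrix.trace_add, Complex.add_re]
    have := (Complex.le_def.mp
      ((hRe (h *ᵥ e) e).mul_mul_conjTranspose_same φ).trace_nonneg).1
    simp only [Complex.zero_re] at this
    linarith

end Measurement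

/-! ### Averaging over the hash function and the collision bound. -/

section Average

variable {n m : ℕ} {E : Type*} [Fintype E] [DecidableEq E]
  {S : Matrix E E ℂ} (hS : S.PosSemidef) {q : Bits n → Matrix E E ℂ}

theorem sum_trace_bin_mul_bin (g : Bits n → Bits m) :
    ∑ k, (bin hS q g k * bin hS q g k).trace.re =
      ∑ a, ∑ b, (if g a = g b then 1 else 0) *
        (sandwich hS (q a) * sandwich hS (q b)).trace.re := by
  rw [← Finset.sum_fiberwise (s := Finset.univ) (g := g)]
  refine Finset.sum_congr rfl fun k _ => ?_
  rw [bin, Finset.sum_mul_sum, Matrix.trace_sum, Complex.re_sum]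
  refine Finset.sum_congr rfl fun a ha => ?_
  rw [Matrix.trace_sum, Complex.re_sum, Finset.sum_filter]
  refine Finset.sum_congr rfl fun b _ => ?_
  rw [(Finset.mem_filter.mp ha).2]
  by_cases hb : g b = k
  · simp [hb]
  · simp [hb, Ne.symm hb]

/-- The average of the collision term of a universal₂ hash function. -/
theorem sum_prob_mul_trace_bin_le (hq : ∀ a, (q a).PosSemidef) (hsum : ∑ a, q a = S)
    {G : RandomHash n m} (hG : G.IsUniversal₂) :
    ∑ g ∈ G.family, G.prob g * ∑ k, (bin hS q g k * bin hS q g k).trace.re ≤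
      ∑ a, (sandwich hS (q a) * sandwich hS (q a)).trace.re + ((2 : ℝ) ^ m)⁻¹ * S.trace.re := by
  set d : Bits n → Bits n → ℝ := fun a b =>
    (sandwich hS (q a) * sandwich hS (q b)).trace.re with hd
  have hd0 (a b : Bits n) : 0 ≤ d a b :=
    trace_mul_nonneg (sandwich_posSemidef hS (hq a)) (sandwich_posSemidef hS (hq b))
  -- `S` is the square of `S^(1/2) = ∑ sandwich hS (q a)`.
  have hS' : S.trace.re = ∑ a, ∑ b, d a b := by
    have := congrArg (fun M : Matrix E E ℂ => M.trace.re) (rootPow_two_mul_self hS)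
    rw [← this, ← sum_sandwich hS hsum, Finset.sum_mul_sum]
    simp only [Matrix.trace_sum, Complex.re_sum, hd]
  have hcol (a b : Bits n) : ∑ g ∈ G.family, G.prob g * (if g a = g b then 1 else 0) ≤
      (if a = b then 1 else 0) + ((2 : ℝ) ^ m)⁻¹ := by
    split_ifs with hab
    · subst hab
      simp only [if_true, mul_one, G.prob_sum]
      have : (0 : ℝ) ≤ ((2 : ℝ) ^ m)⁻¹ := by positivity
      linarith
    · simpa using hG a b hab
  calc ∑ g ∈ G.family, G.prob g * ∑ k, (bin hS q g k * bin hS q g k).trace.re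
      = ∑ a, ∑ b, (∑ g ∈ G.family, G.prob g * (if g a = g b then 1 else 0)) * d a b := by
        simp only [sum_trace_bin_mul_bin, Finset.mul_sum, Finset.sum_mul]
        rw [Finset.sum_comm]
        refine Finset.sum_congr rfl fun a _ => ?_
        rw [Finset.sum_comm]
        simp only [mul_assoc, hd]
    _ ≤ ∑ a, ∑ b, ((if a = b then 1 else 0) + ((2 : ℝ) ^ m)⁻¹) * d a b :=
        Finset.sum_le_sum fun a _ => Finset.sum_le_sum fun b _ =>
          mul_le_mul_of_nonneg_right (hcol a b) (hd0 a b)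
    _ = ∑ a, d a a + ((2 : ℝ) ^ m)⁻¹ * S.trace.re := by
        rw [hS']
        simp only [add_mul, Finset.sum_add_distrib, ite_mul, one_mul, zero_mul, Finset.sum_ite_eq,
          Finset.mem_univ, if_true, Finset.mul_sum]

theorem one_sub_supp_posSemidef : (1 - supp hS).PosSemidef := by
  have hidem : supp hS * supp hS = supp hS := by
    rw [supp, hfun_mul]
    congr 1
    ext x
    by_cases h : fourthRoot x = 0
    · simp [h]
    · simp [h]
  have : 1 - supp hS = (1 - supp hS)ᴴ * (1 - supp hS) := by
    rw [Matrix.conjTranspose_sub, Matrix.conjTranspose_one, supp_isHermitian, Matrix.mul_sub,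
      Matrix.sub_mul, Matrix.sub_mul, hidem]
    simp
  rw [this]
  exact Matrix.posSemidef_conjTranspose_mul_self _

/-- The conditional collision probability is bounded by the guessing probability. -/
theorem sum_trace_sandwich_mul_self_le (hq : ∀ a, (q a).PosSemidef) (hsum : ∑ a, q a = S)
    {σ : Matrix E E ℂ} (hσ : IsNormalized σ) {c : ℝ} (hc : 0 ≤ c)
    (hle : ∀ a, ((c : ℂ) • σ - q a).PosSemidef) :
    ∑ a, (sandwich hS (q a) * sandwich hS (q a)).trace.re ≤ c := by
  -- The double sandwich is `S^(-1/2) q_a S^(-1/2)`. Pairing it with `q_a ≤ c σ` bounds the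
  -- collision term, and over all `a` it sums to the support projection of `S`.
  have hX (a : Bits n) : (sandwich hS (sandwich hS (q a))).PosSemidef :=
    sandwich_posSemidef hS (sandwich_posSemidef hS (hq a))
  have h1 (a : Bits n) : (sandwich hS (q a) * sandwich hS (q a)).trace.re ≤
      c * (σ * sandwich hS (sandwich hS (q a))).trace.re := by
    have := trace_mul_nonneg (hle a) (hX a)
    rw [Matrix.sub_mul, Matrix.trace_sub, Matrix.smul_mul, Matrix.trace_smul, smul_eq_mul,
      Complex.sub_re, Complex.re_ofReal_mul] at this
    have e : (sandwich hS (q a) * sandwich hS (q a)).trace =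
        (q a * sandwich hS (sandwich hS (q a))).trace := by
      conv_lhs => enter [1, 1]; rw [sandwich]
      conv_rhs => enter [1, 2]; rw [sandwich]
      rw [Matrix.mul_assoc, Matrix.mul_assoc, Matrix.trace_mul_comm]
      simp only [Matrix.mul_assoc]
    rw [e]
    linarith
  have hsupp : ∑ a, sandwich hS (sandwich hS (q a)) = supp hS := by
    rw [← sandwich_sum hS (q := fun a => sandwich hS (q a)), sum_sandwich hS hsum]
    simp only [sandwich, rootInv, rootPow, supp, hfun_mul]
    congr 1
    ext x
    by_cases h : fourthRoot x = 0
    · simp [h]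
    · field_simp
  calc ∑ a, (sandwich hS (q a) * sandwich hS (q a)).trace.re
      ≤ ∑ a, c * (σ * sandwich hS (sandwich hS (q a))).trace.re :=
        Finset.sum_le_sum fun a _ => h1 a
    _ = c * (σ * supp hS).trace.re := by
        rw [← Finset.mul_sum, ← Complex.re_sum, ← Matrix.trace_sum, ← Finset.mul_sum, hsupp]
    _ ≤ c * 1 := by
        refine mul_le_mul_of_nonneg_left ?_ hc
        have := trace_mul_nonneg hσ.1 (one_sub_supp_posSemidef hS)
        rw [Matrix.mul_sub, Matrix.mul_one, Matrix.trace_sub, Complex.sub_re, hσ.2,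
          Complex.one_re] at this
        linarith
    _ = c := mul_one c

end Average

theorem cq_apply {n : ℕ} {E : Type*} {ρ : Matrix (Bits n × E) (Bits n × E) ℂ}
    {q : Bits n → Matrix E E ℂ} (hρ : ρ = ∑ a, Matrix.single a a (1 : ℂ) ⊗ₖ q a)
    (a : Bits n) (e f : E) :
    ρ (a, e) (a, f) = q a e f := by
  rw [hρ, Matrix.sum_apply, Finset.sum_eq_single a]
  · simp
  · intro c _ hc
    simp [hc]
  · simp

theorem single_posSemidef {ι : Type*} [Fintype ι] [DecidableEq ι] (a : ι) :
    (Matrix.single a a (1 : ℂ)).PosSemidef := by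
  rw [← Matrix.diagonal_single]
  exact Matrix.PosSemidef.diagonal (Pi.single_nonneg.mpr zero_le_one)

/-! ### Min-entropy of a classical-quantum state. -/

section MinEntropy

variable {n : ℕ} {E : Type*}
  {ρ : Matrix (Bits n × E) (Bits n × E) ℂ} {q : Bits n → Matrix E E ℂ}

theorem trace_cq [Fintype E] (hρ : ρ = ∑ a, Matrix.single a a (1 : ℂ) ⊗ₖ q a) :
    ρ.trace = (∑ a, q a).trace := by
  rw [Matrix.trace_sum]
  simp only [Matrix.trace, Fintype.sum_prod_type, Matrix.diag_apply, cq_apply hρ]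

theorem posSemidef_block (hρ : ρ = ∑ a, Matrix.single a a (1 : ℂ) ⊗ₖ q a) {c : ℂ}
    {σ : Matrix E E ℂ} (h : (c • ((1 : Matrix (Bits n) (Bits n) ℂ) ⊗ₖ σ) - ρ).PosSemidef)
    (a : Bits n) : (c • σ - q a).PosSemidef := by
  convert h.submatrix (fun e : E => (a, e)) using 1
  ext e f
  simp [cq_apply hρ]

/-- The witness is `σ = S / Tr S` with `l = -log₂ Tr S`, for which `2^(-l) σ = S`, and `S ≥ q a` for
every `a`. -/
theorem minEntropySet_nonempty [Fintype E] [DecidableEq E]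
    (hρ : ρ = ∑ a, Matrix.single a a (1 : ℂ) ⊗ₖ q a) (hq : ∀ a, (q a).PosSemidef) (hρ0 : ρ ≠ 0) : (minEntropySet ρ).Nonempty := by
  have hS : (∑ a, q a).PosSemidef := Matrix.posSemidef_sum _ fun a _ => hq a
  have hpos : ρ.PosSemidef := by
    rw [hρ]
    refine Matrix.posSemidef_sum _ fun a _ => Matrix.PosSemidef.kronecker (single_posSemidef a) (hq a)
  have htr : (∑ a, q a).trace ≠ 0 := by
    rw [← trace_cq hρ]
    exact fun h => hρ0 (hpos.trace_eq_zero_iff.mp h)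
  have htr0 := hS.trace_nonneg
  set t := (∑ a, q a).trace with ht
  obtain ⟨x, hx⟩ : ∃ x : ℝ, (x : ℂ) = t := ⟨t.re, by
    rw [Complex.ext_iff]
    exact ⟨by simp, by simpa using (Complex.nonneg_iff.mp htr0).2⟩⟩
  have hx0 : 0 < x := by
    rw [← hx] at htr htr0
    have h1 : x ≠ 0 := by exact_mod_cast htr
    have h2 : 0 ≤ x := by exact_mod_cast htr0
    exact lt_of_le_of_ne h2 h1.symm
  refine ⟨-Real.logb 2 x, (x⁻¹ : ℂ) • ∑ a, q a, ⟨?_, ?_⟩, ?_⟩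
  · refine hS.smul ?_
    rw [← Complex.ofReal_inv]
    exact_mod_cast (inv_pos.mpr hx0).le
  · rw [Matrix.trace_smul, smul_eq_mul, ← ht, hx, inv_mul_cancel₀ htr]
  · rw [neg_neg, Real.rpow_logb (by norm_num) (by norm_num) hx0]
    have e : (x : ℂ) • ((1 : Matrix (Bits n) (Bits n) ℂ) ⊗ₖ ((x⁻¹ : ℂ) • ∑ a, q a)) - ρ =
        ∑ a, Matrix.single a a (1 : ℂ) ⊗ₖ (∑ b with b ≠ a, q b) := by
      have hx' : (x : ℂ) ≠ 0 := by exact_mod_cast hx0.ne'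
      have h1 : (1 : Matrix (Bits n) (Bits n) ℂ) = ∑ a, Matrix.single a a (1 : ℂ) := by
        ext i j
        rw [Matrix.sum_apply, Matrix.one_apply]
        simp [Matrix.single_apply, ite_and]
      have h2 (a : Bits n) : ∑ b with b ≠ a, q b = (∑ b, q b) - q a := by
        rw [Finset.filter_ne', eq_sub_iff_add_eq, Finset.sum_erase_add _ _ (Finset.mem_univ a)]
      rw [Matrix.kronecker_smul, smul_smul, mul_inv_cancel₀ hx', one_smul, hρ, h1]
      simp only [h2]
      ext ⟨i, e⟩ ⟨j, f⟩
      simp only [Matrix.sub_apply, Matrix.sum_apply, Matrix.kronecker_apply, mul_sub,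
        Finset.sum_sub_distrib, Finset.sum_mul]
    rw [e]
    refine Matrix.posSemidef_sum _ fun a _ => Matrix.PosSemidef.kronecker (single_posSemidef a)
      (Matrix.posSemidef_sum _ fun b _ => hq b)

/-- This passes the bound to the supremum without attainment: for `B > 0` the hypothesis itself
bounds every `l` by `-log₂ B`, and for `B ≤ 0` nothing is needed. -/
theorem le_rpow_neg_sSup {B : ℝ} {L : Set ℝ} (hL : L.Nonempty)
    (h : ∀ l ∈ L, B ≤ (2 : ℝ) ^ (-l)) : B ≤ (2 : ℝ) ^ (-sSup L) := by
  by_cases hB : B ≤ 0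
  · exact hB.trans (by positivity)
  · push Not at hB
    have : sSup L ≤ -Real.logb 2 B := csSup_le hL fun l hl => by
      have := (Real.logb_le_iff_le_rpow (b := 2) (by norm_num) hB).mpr (h l hl)
      linarith
    rw [← Real.logb_le_iff_le_rpow (by norm_num) hB]
    linarith

end MinEntropy

end PhaseEC
end

theorem mainTheorem1 {n m : ℕ} {E A' : Type*}
    [Fintype E] [DecidableEq E] [Fintype A'] [DecidableEq A']
    -- the initial nonzero sub-normalized cq state on `A ⊗ E` and a purification on `A ⊗ E ⊗ A'`
    (ρ : Matrix (PhaseEC.Bits n × E) (PhaseEC.Bits n × E) ℂ)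
    (hρ : PhaseEC.IsSubnormalized ρ) (hcq : PhaseEC.IsCQ ρ) (hρ0 : ρ ≠ 0)
    (Ψ : (PhaseEC.Bits n × E) × A' → ℂ) (hΨ : PhaseEC.IsPurification Ψ ρ)
    -- the random hash function and a check matrix of the code `(ker g)^⊥` for each `g`
    (G : PhaseEC.RandomHash n m) (hG : G.IsUniversal₂)
    (h : (PhaseEC.Bits n →ₗ[ZMod 2] PhaseEC.Bits m) → Matrix (Fin (n - m)) (Fin n) (ZMod 2))
    (hh : ∀ g ∈ G.family, PhaseEC.IsCheckMatrix (h g) (PhaseEC.code g)) :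
    -- the ancilla measurements, depending on `g` and on the syndrome `s`
    ∃ M : (PhaseEC.Bits n →ₗ[ZMod 2] PhaseEC.Bits m) → PhaseEC.Bits (n - m) →
        PhaseEC.Bits n → Matrix A' A' ℂ,
      (∀ g ∈ G.family, ∀ s, PhaseEC.IsMeasurement (M g s)) ∧
      ∑ g ∈ G.family, G.prob g *
          PhaseEC.phaseErrorProb
            (PhaseEC.ptrace (PhaseEC.ptrace
              (PhaseEC.pec (h g) (M g) (PhaseEC.ketbra Ψ))))
        ≤ (2 : ℝ) ^ ((m : ℝ) - PhaseEC.minEntropy ρ) := by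
  obtain ⟨q, hq, hρq⟩ := hcq
  have hS : (∑ a, q a).PosSemidef := Matrix.posSemidef_sum _ fun a _ => hq a
  have hT := PhaseEC.bitComp_mul_conjTranspose hΨ hρq
  have hex (g : PhaseEC.Bits n →ₗ[ZMod 2] PhaseEC.Bits m) :
      ∃ M : PhaseEC.Bits (n - m) → PhaseEC.Bits n → Matrix A' A' ℂ, g ∈ G.family →
        (∀ s, PhaseEC.IsMeasurement (M s)) ∧
        PhaseEC.phaseErrorProb (PhaseEC.ptrace (PhaseEC.ptrace
          (PhaseEC.pec (h g) M (PhaseEC.ketbra Ψ)))) ≤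
          2 ^ m * ∑ k, (PhaseEC.bin hS q g k * PhaseEC.bin hS q g k).trace.re -
            (∑ a, q a).trace.re := by
    by_cases hg : g ∈ G.family
    · obtain ⟨M, hM, hle⟩ := PhaseEC.exists_measurement_ge (h g) _
        (PhaseEC.one_sub_sum_decoder_posSemidef hS hq hT (G.surjective g hg) (hh g hg))
      refine ⟨M, fun _ => ⟨hM, ?_⟩⟩
      rw [PhaseEC.phaseErrorProb_pec (h g) M hM hΨ, PhaseEC.trace_cq hρq]
      have h1 := PhaseEC.le_sum_trace_decoder hS hq g hT rfl
      have h2 := Finset.sum_le_sum fun e (_ : e ∈ Finset.univ) =>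
        hle e (PhaseEC.phaseComp Ψ e)
      have h3 := h1.trans h2
      linarith
    · exact ⟨0, fun hg' => absurd hg' hg⟩
  choose M hM using hex
  refine ⟨M, fun g hg => (hM g hg).1, ?_⟩
  have havg := PhaseEC.sum_prob_mul_trace_bin_le hS hq rfl hG
  set B := ∑ a, (PhaseEC.sandwich hS (q a) * PhaseEC.sandwich hS (q a)).trace.re with hB
  have hBle : B ≤ (2 : ℝ) ^ (-PhaseEC.minEntropy ρ) := by
    refine PhaseEC.le_rpow_neg_sSup (PhaseEC.minEntropySet_nonempty hρq hq hρ0) ?_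
    rintro l ⟨σ, hσ, hle⟩
    exact PhaseEC.sum_trace_sandwich_mul_self_le hS hq rfl hσ (by positivity)
      (PhaseEC.posSemidef_block hρq hle)
  have h2m : (0 : ℝ) < 2 ^ m := by positivity
  calc _ ≤ ∑ g ∈ G.family, G.prob g * (2 ^ m *
          ∑ k, (PhaseEC.bin hS q g k * PhaseEC.bin hS q g k).trace.re - (∑ a, q a).trace.re) :=
        Finset.sum_le_sum fun g hg =>
          mul_le_mul_of_nonneg_left (hM g hg).2 (G.prob_nonneg g hg)
    _ = 2 ^ m * ∑ g ∈ G.family, G.prob g *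
          ∑ k, (PhaseEC.bin hS q g k * PhaseEC.bin hS q g k).trace.re -
            (∑ a, q a).trace.re := by
        simp only [mul_sub, Finset.sum_sub_distrib, ← Finset.sum_mul, G.prob_sum, one_mul]
        rw [Finset.mul_sum]
        congr 1
        exact Finset.sum_congr rfl fun g _ => by ring
    _ ≤ 2 ^ m * (B + ((2 : ℝ) ^ m)⁻¹ * (∑ a, q a).trace.re) - (∑ a, q a).trace.re :=
        sub_le_sub_right (mul_le_mul_of_nonneg_left havg h2m.le) _
    -- The contribution `2^(-m) Tr S` of accidental collisions exactly cancels the subtracted trace.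
    _ = 2 ^ m * B := by
        field_simp
        ring
    _ ≤ 2 ^ m * (2 : ℝ) ^ (-PhaseEC.minEntropy ρ) := mul_le_mul_of_nonneg_left hBle h2m.le
    _ = (2 : ℝ) ^ ((m : ℝ) - PhaseEC.minEntropy ρ) := by
        rw [sub_eq_add_neg, Real.rpow_add (by norm_num), Real.rpow_natCast]
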